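/- Let $K$ be a field of characteristic different from $2$. For an $[n,k,d]$-linear code over $K$ with generating matrix $G$ (i.e. the image of the injective map $K^k\to K^n$, $x\mapsto xG$, with $d$ the smallest number of nonzero entries of a nonzero codeword), let $\ell_1,\dots,\ell_n\in K[x_1,\dots,x_k]$ be the linear forms dual to the columns of $G$, and assume that $\gcd(\ell_i,\ell_j)=1$ for $i\ne j$. Its Orlik–Terao algebra is $\mathrm{OT}=S/\ker\phi$, where $S=K[y_1,\dots,y_n]$ and $\phi:S\to K(x_1,\dots,x_k)$ is the $K$-algebra homomorphism with $\phi(y_i)=1/\ell_i$; it is graded by the degree in the $y_i$. (1) The forms $(x,y,z,x-y,x-z,y-z)$ define a $[6,3,3]$-linear code $\mathcal C_1$ and the forms $(x,y,x+y,x-y,z,y-z)$ define a $[6,3,2]$-linear code $\mathcal C_2$. In both cases the forms are pairwise coprime, and for both codes the minimal graded free resolution of the Orlik–Terao algebra over $S=K[y_1,\dots,y_6]$ has the shape $$0\to S^2(-5)\to S^3(-4)\oplus S^2(-3)\to S^4(-2)\to S\to \mathrm{OT}(\mathcal C_i)\to 0 .$$ (2) Consequently the minimum distance is not determined by the graded Betti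 numbers of the Orlik–Terao algebra, not even together with the length and the dimension: there is no function $f$ such that $d=f(n,k,\beta)$ for every $[n,k,d]$-linear code over $K$ with pairwise coprime forms, where $\beta=(\beta_{i,j})$ is the table of graded Betti numbers of its Orlik–Terao algebra over $K[y_1,\dots,y_n]$. -/

import Mathlib

/-! ### Linear codes given by a generating matrix -/

/-- The code with generating matrix `G`: the image of `K ^ k → K ^ n`, `x ↦ x G`. -/
def matrixCode {K : Type*} [Field K] {n k : ℕ} (G : Matrix (Fin k) (Fin n) K) :
    Submodule K (Fin n → K) :=
  LinearMap.range G.vecMulLinear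

/-- `C` is an `[n, k, d]`-linear code: a `k`-dimensional subspace of `K ^ n` for which `d` is the
smallest number of nonzero entries of a nonzero codeword. -/
def IsLinearCode {K : Type*} [Field K] [DecidableEq K] {n : ℕ} (C : Submodule K (Fin n → K))
    (k d : ℕ) : Prop :=
  Module.finrank K C = k ∧ IsLeast {w : ℕ | ∃ c ∈ C, c ≠ 0 ∧ hammingNorm c = w} d

/-- The linear forms `ℓ₁, …, ℓₙ` in `K[x₁, …, xₖ]` dual to the columns of `G`. -/
noncomputable def linearForms {K : Type*} [Field K] {n k : ℕ} (G : Matrix (Fin k) (Fin n) K) :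
    Fin n → MvPolynomial (Fin k) K :=
  fun j => ∑ i, MvPolynomial.C (G i j) * MvPolynomial.X i

/-! ### The Orlik–Terao algebra -/

/-- The homomorphism `K[y₁, …, yₙ] → K(x₁, …, xₖ)`, `yᵢ ↦ 1 / ℓᵢ`, whose image is the subalgebra
`K[1 / ℓ₁, …, 1 / ℓₙ]`. -/
noncomputable def orlikTeraoMap {K : Type*} [Field K] {n k : ℕ}
    (ℓ : Fin n → MvPolynomial (Fin k) K) :
    MvPolynomial (Fin n) K →ₐ[K] FractionRing (MvPolynomial (Fin k) K) :=
  MvPolynomial.aeval fun i =>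
    (algebraMap (MvPolynomial (Fin k) K) (FractionRing (MvPolynomial (Fin k) K)) (ℓ i))⁻¹

/-- The Orlik–Terao ideal of the forms `ℓ`. -/
noncomputable def orlikTeraoIdeal {K : Type*} [Field K] {n k : ℕ}
    (ℓ : Fin n → MvPolynomial (Fin k) K) : Ideal (MvPolynomial (Fin n) K) :=
  RingHom.ker (orlikTeraoMap ℓ)

/-- The Orlik–Terao algebra of the forms `ℓ`. -/
abbrev OrlikTeraoAlgebra {K : Type*} [Field K] {n k : ℕ}
    (ℓ : Fin n → MvPolynomial (Fin k) K) : Type _ :=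
  MvPolynomial (Fin n) K ⧸ orlikTeraoIdeal ℓ

/-- The homogeneous components of the Orlik–Terao algebra: the component of degree `e` consists
of the classes of the homogeneous polynomials of degree `e`. -/
noncomputable def orlikTeraoGrading {K : Type*} [Field K] {n k : ℕ}
    (ℓ : Fin n → MvPolynomial (Fin k) K) (e : ℕ) : Submodule K (OrlikTeraoAlgebra ℓ) :=
  (MvPolynomial.homogeneousSubmodule (Fin n) K e).map
    (Ideal.Quotient.mkₐ K (orlikTeraoIdeal ℓ)).toLinearMap

/-! ### Minimal graded free resolutions -/

/-- The graded free module `⨁ⱼ S(-j) ^ (b j)` over `S = K[y₁, …, yₙ]`. The basis element with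
index `⟨j, t⟩` has degree `j`. -/
abbrev GradedFree (K : Type*) [Field K] (n : ℕ) (b : ℕ → ℕ) : Type _ :=
  (Σ j : ℕ, Fin (b j)) →₀ MvPolynomial (Fin n) K

/-- `v` lies in the component of degree `e` of `⨁ⱼ S(-j) ^ (b j)`: its coordinate at a basis
element of degree `j` involves only monomials of degree `e - j` (none if `e < j`). -/
def GradedFree.IsHomogeneous {K : Type*} [Field K] {n : ℕ} {b : ℕ → ℕ} (v : GradedFree K n b)
    (e : ℕ) : Prop :=
  ∀ p : Σ j : ℕ, Fin (b j), ∀ m ∈ (v p).support, m.degree + p.1 = e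

/-- A minimal graded free resolution
`⋯ → ⨁ⱼ S(-j) ^ (β 1 j) → ⨁ⱼ S(-j) ^ (β 0 j) → M → 0`
over `S = K[y₁, …, yₙ]` of an `S`-module `M` with homogeneous components `𝓜 e`. -/
structure MinimalGradedFreeResolution {K : Type*} [Field K] {n : ℕ} {M : Type*} [AddCommGroup M]
    [Module K M] [Module (MvPolynomial (Fin n) K) M] [IsScalarTower K (MvPolynomial (Fin n) K) M]
    (𝓜 : ℕ → Submodule K M)
    (β : ℕ → ℕ → ℕ) where
  /-- the augmentation -/
  aug : GradedFree K n (β 0) →ₗ[MvPolynomial (Fin n) K] M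
  /-- the differentials -/
  diff : ∀ i : ℕ, GradedFree K n (β (i + 1)) →ₗ[MvPolynomial (Fin n) K] GradedFree K n (β i)
  aug_homogeneous : ∀ (v : GradedFree K n (β 0)) (e : ℕ), v.IsHomogeneous e → aug v ∈ 𝓜 e
  diff_homogeneous : ∀ (i : ℕ) (v : GradedFree K n (β (i + 1))) (e : ℕ),
    v.IsHomogeneous e → GradedFree.IsHomogeneous (diff i v) e
  aug_surjective : Function.Surjective aug
  exact_zero : Function.Exact (diff 0) aug
  exact_succ : ∀ i : ℕ, Function.Exact (diff (i + 1)) (diff i)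
  /-- minimality: the image of each differential lies in `(y₁, …, yₙ)` times its target -/
  minimal : ∀ i : ℕ, LinearMap.range (diff i) ≤
    Ideal.span (Set.range (MvPolynomial.X : Fin n → MvPolynomial (Fin n) K)) •
      (⊤ : Submodule (MvPolynomial (Fin n) K) (GradedFree K n (β i)))

/-- `β` is the table of graded Betti numbers of the Orlik–Terao algebra of the forms `ℓ`: in its
minimal graded free resolution over `S = K[y₁, …, yₙ]` the `i`-th free module is
`⨁ⱼ S(-j) ^ (β i j)`. -/
def IsOrlikTeraoBetti {K : Type*} [Field K] {n k : ℕ} (ℓ : Fin n → MvPolynomial (Fin k) K)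
    (β : ℕ → ℕ → ℕ) : Prop :=
  Nonempty (MinimalGradedFreeResolution (n := n) (orlikTeraoGrading ℓ) β)

/-- The Betti table of a resolution of the shape
`0 → S(-5)² → S(-4)³ ⊕ S(-3)² → S(-2)⁴ → S`. -/
def commonBettiTable : ℕ → ℕ → ℕ
  | 0, 0 => 1
  | 1, 2 => 4
  | 2, 3 => 2
  | 2, 4 => 3
  | 3, 5 => 2
  | _, _ => 0

/-! For both arrangements the Orlik–Terao ideal is `(q) + J`, where `q` is the quadric relation of
one circuit of three forms and `J` is the ideal of maximal minors of a `2 × 3` matrix of linear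
forms. Since `J` is prime and does not contain `q`, the quadric is a nonzerodivisor modulo `J`. The
tensor product of the Hilbert–Burch complex of `J` with the Koszul complex of `q` is then the
minimal resolution, and its shape depends on no further data
(`nonempty_resolution_of_quadric_of_signedMinors`).

Two facts about kernels remain: the ideal `(q) + J` is the whole kernel of `yᵢ ↦ 1 / ℓᵢ`, and `J` is
prime, being the kernel of a map to a field with four independent parameters. Both follow from
partial fractions. The variables of the target are introduced one at a time. At each stage the new
generators have simple poles at distinct points of the field already reached, and the known
relations turn a product of two of them into a linear combination of the two. Every element of the
quotient thus has a partial fraction form, whose uniqueness in the target gives injectivity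
(`eq_zero_of_mem_adjoin_simple_poles`, `ker_eq_of_embedsInto`).

The minimum distances differ because `n - d` is the largest number of forms vanishing at a common
nonzero point: three for the first arrangement, four for the second. -/

/-! ### Algebras with partial fraction normal forms -/

section PartialFractions

variable {K R L : Type*} [Field K] [CommRing R] [Algebra K R] [Field L] [Algebra K L]

/-- The combinations `a + ∑ i, u i * p i (u i)` of powers of the elements `u i` with coefficients
in the subalgebra `A`. -/
noncomputable def powerCombination (A : Subalgebra K R) {ι : Type*} [Fintype ι] (u : ι → R) :
    (A × (ι → Polynomial A)) →ₗ[A] R where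
  toFun x := (x.1 : R) + ∑ i, u i * Polynomial.aeval (u i) (x.2 i)
  map_add' x y := by
    simp only [Prod.fst_add, Prod.snd_add, Pi.add_apply, map_add, mul_add, Finset.sum_add_distrib,
      Subalgebra.coe_add]
    ring
  map_smul' a x := by
    simp only [Prod.smul_fst, Prod.smul_snd, Pi.smul_apply, map_smul, smul_eq_mul,
      Subalgebra.coe_mul, RingHom.id_apply, Subalgebra.smul_def, mul_add,
      Finset.mul_sum]
    congr 1
    exact Finset.sum_congr rfl fun i _ => by ring

/-- The relations `hrel` eliminate mixed monomials: by induction on the exponent, `u j * u i ^ m` is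
an `A`-combination of pure powers. The range is therefore stable under multiplication by all
generators, and it contains `1`. -/
theorem adjoin_le_range_powerCombination (A : Subalgebra K R) {ι : Type*} [Fintype ι] (u : ι → R)
    (hrel : ∀ i j, i ≠ j → ∃ a b : A, u i * u j = a * u i + b * u j) :
    ∀ r ∈ Algebra.adjoin K ((A : Set R) ∪ Set.range u),
      r ∈ LinearMap.range (powerCombination A u) := by
  classical
  set N := LinearMap.range (powerCombination A u) with hN
  have hbase : ∀ a : A, (a : R) ∈ N := fun a => ⟨(a, 0), by simp [powerCombination]⟩
  have hpow : ∀ i m, u i ^ m ∈ N := by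
    intro i m
    cases m with
    | zero => simpa using hbase 1
    | succ m =>
      -- The summand is `u i * p i (u i)`, so exponent `m` in `p i` yields the power `m + 1`.
      refine ⟨(0, Pi.single i (Polynomial.X ^ m)), ?_⟩
      simp only [powerCombination, LinearMap.coe_mk, AddHom.coe_mk, ZeroMemClass.coe_zero, zero_add]
      rw [Finset.sum_eq_single i]
      · simp [pow_succ']
      · intro j _ hj
        simp [hj]
      · simp
  have hsmul : ∀ (a : A) {n : R}, n ∈ N → (a : R) * n ∈ N := fun a n hn => N.smul_mem a hn
  have hmulpow : ∀ j i m, u j * u i ^ m ∈ N := by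
    intro j i m
    by_cases hij : i = j
    · subst hij
      simpa [pow_succ'] using hpow i (m + 1)
    · induction m with
      | zero => simpa using hpow j 1
      | succ m ih =>
        obtain ⟨a, b, h⟩ := hrel i j hij
        have : u j * u i ^ (m + 1) = a * u i ^ (m + 1) + b * (u j * u i ^ m) := by
          linear_combination u i ^ m * h
        rw [this]
        exact N.add_mem (hsmul _ (hpow _ _)) (hsmul _ ih)
  have hu : ∀ j, ∀ n ∈ N, u j * n ∈ N := by
    rintro j _ ⟨⟨a, p⟩, rfl⟩
    simp only [powerCombination, LinearMap.coe_mk, AddHom.coe_mk, mul_add, Finset.mul_sum]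
    refine N.add_mem ?_ (N.sum_mem fun i _ => ?_)
    · rw [mul_comm]
      exact hsmul a (by simpa using hpow j 1)
    · rw [Polynomial.aeval_eq_sum_range, Finset.mul_sum, Finset.mul_sum]
      refine N.sum_mem fun m _ => ?_
      have : u j * (u i * (p i).coeff m • u i ^ m) =
          ((p i).coeff m : R) * (u j * u i ^ (m + 1)) := by
        rw [Subalgebra.smul_def, smul_eq_mul]
        ring
      rw [this]
      exact hsmul _ (hmulpow _ _ _)
  intro r hr
  suffices ∀ n ∈ N, r * n ∈ N by simpa using this 1 (by simpa using hbase 1)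
  induction hr using Algebra.adjoin_induction with
  | mem x hx =>
    rcases hx with hx | ⟨i, rfl⟩
    · exact fun n hn => hsmul ⟨x, hx⟩ hn
    · exact hu i
  | algebraMap k => exact fun n hn => hsmul (algebraMap K A k) hn
  | add x y _ _ hx hy => exact fun n hn => by rw [add_mul]; exact N.add_mem (hx n hn) (hy n hn)
  | mul x y _ _ hx hy => exact fun n hn => by rw [mul_assoc]; exact hx _ (hy n hn)

/-- Uniqueness of partial fractions over `F(z)`: as `z` is transcendental, it behaves like a
polynomial variable. The denominators `X - c i` have degree one, so the numerators are constants. -/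
theorem eq_zero_of_sum_inv_pow_eq_zero {F : IntermediateField K L} {z : L} (hz : Transcendental F z)
    {ι : Type*} [Fintype ι] (c : ι → F) (hc : Function.Injective c) (n : ι → ℕ) (a : F)
    (b : (i : ι) → Fin (n i) → F)
    (h : (a : L) + ∑ i, ∑ j, (b i j : L) * (z - c i)⁻¹ ^ (j.1 + 1) = 0) :
    a = 0 ∧ ∀ i j, b i j = 0 := by
  -- Sending `X` to `z` makes `L` a field containing `F[X]`, as uniqueness of partial fractions
  -- requires.
  let _ : Algebra (Polynomial F) L := (Polynomial.aeval z).toRingHom.toAlgebra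
  have hmap : ∀ p : Polynomial F, algebraMap (Polynomial F) L p = Polynomial.aeval z p :=
    fun p => rfl
  have hinj : Function.Injective (algebraMap (Polynomial F) L) :=
    transcendental_iff_injective.mp hz
  have : FaithfulSMul (Polynomial F) L := (faithfulSMul_iff_algebraMap_injective _ _).mpr hinj
  have hne : ∀ i, z - c i ≠ 0 := by
    intro i hi
    have : algebraMap (Polynomial F) L (Polynomial.X - Polynomial.C (c i)) = 0 := by
      simpa [hmap] using hi
    exact Polynomial.X_sub_C_ne_zero (c i) (hinj (by rw [this, map_zero]))
  have key := Polynomial.quo_add_sum_rem_mul_pow_inverse_unique (R := F) (K := L)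
    (s := Finset.univ) (g := fun i => Polynomial.X - Polynomial.C (c i))
    (fun i _ => Polynomial.monic_X_sub_C _)
    (fun i _ j _ hij => Polynomial.isCoprime_X_sub_C_of_isUnit_sub
      (IsUnit.mk0 _ (sub_ne_zero.mpr (hc.ne hij))))
    (n := n) (gi := fun i => (z - c i)⁻¹)
    (fun i _ => by simpa [hmap] using inv_mul_cancel₀ (hne i))
    (q₁ := Polynomial.C a) (q₂ := 0) (r₁ := fun i j => Polynomial.C (b i j)) (r₂ := fun _ _ => 0)
    (fun i _ j => by
      rw [Polynomial.degree_X_sub_C]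
      exact lt_of_le_of_lt Polynomial.degree_C_le (by norm_num))
    (fun i _ j => by simp)
    (by simpa [hmap] using h)
  refine ⟨by simpa using key.1, fun i j => ?_⟩
  simpa using congrFun (key.2 i (Finset.mem_univ i)) j

/-- If `ψ` is injective on `A`, and the `ψ (u i)` have simple poles at distinct points over a field
containing `ψ A`, and the products `u i * u j` reduce linearly over `A`, then `ψ` is injective on
the algebra generated by `A` and the `u i`. -/
theorem eq_zero_of_mem_adjoin_simple_poles (ψ : R →ₐ[K] L) (A : Subalgebra K R)
    (hA : ∀ a ∈ A, ψ a = 0 → a = 0) (F : IntermediateField K L) (hAF : ∀ a ∈ A, ψ a ∈ F)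
    {z : L} (hz : Transcendental F z) {ι : Type*} [Fintype ι] (u : ι → R) (c f : ι → L)
    (hc : Function.Injective c) (hcF : ∀ i, c i ∈ F) (hfF : ∀ i, f i ∈ F) (hf : ∀ i, f i ≠ 0)
    (hu : ∀ i, ψ (u i) = f i * (z - c i)⁻¹)
    (hrel : ∀ i j, i ≠ j → ∃ a ∈ A, ∃ b ∈ A, u i * u j = a * u i + b * u j) :
    ∀ r ∈ Algebra.adjoin K ((A : Set R) ∪ Set.range u), ψ r = 0 → r = 0 := by
  intro r hr hψ
  obtain ⟨⟨a, p⟩, rfl⟩ := adjoin_le_range_powerCombination A u (fun i j hij => by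
    obtain ⟨a, ha, b, hb, h⟩ := hrel i j hij
    exact ⟨⟨a, ha⟩, ⟨b, hb⟩, h⟩) r hr
  -- The image of `u i ^ (j + 1)` carries the factor `f i ^ (j + 1)`. It is absorbed into the
  -- coefficient here and cancelled later because `f i ≠ 0`.
  have key := eq_zero_of_sum_inv_pow_eq_zero hz (fun i => (⟨c i, hcF i⟩ : F))
    (fun i j h => hc (congrArg Subtype.val h)) (fun i => (p i).natDegree + 1)
    ⟨ψ a, hAF a a.2⟩
    (fun i j => ⟨ψ ((p i).coeff j), hAF _ ((p i).coeff j).2⟩ * ⟨f i, hfF i⟩ ^ (j.1 + 1)) (by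
      rw [← hψ]
      simp only [powerCombination, LinearMap.coe_mk, AddHom.coe_mk, map_add, map_sum]
      congr 1
      refine Finset.sum_congr rfl fun i _ => ?_
      rw [Polynomial.aeval_eq_sum_range, Finset.mul_sum, map_sum, Finset.sum_range]
      refine Finset.sum_congr rfl fun m _ => ?_
      rw [Subalgebra.smul_def, smul_eq_mul, map_mul, map_mul, map_pow, hu i]
      push_cast
      ring)
  have ha : a = 0 := by
    apply Subtype.ext
    exact hA a a.2 (congrArg Subtype.val key.1)
  have hp : p = 0 := by
    funext i
    ext m
    by_cases hm : m < (p i).natDegree + 1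
    · have h := key.2 i ⟨m, hm⟩
      rcases mul_eq_zero.mp h with h | h
      · simpa using hA _ ((p i).coeff m).2 (congrArg Subtype.val h)
      · exact absurd (congrArg Subtype.val (pow_eq_zero_iff (by omega) |>.mp h)) (hf i)
    · rw [Polynomial.coeff_eq_zero_of_natDegree_lt (by omega)]
      simp
  rw [ha, hp]
  exact map_zero _

end PartialFractions

/-! ### Resolutions given by matrices -/

section MatrixResolution

open MvPolynomial

/-- Bases in `GradedFree` are indexed by degree and position. This reindexing lets a basis be listed
by a single index with a degree function instead, so that differentials become ordinary matrices. -/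
theorem exists_sigma_equiv_of_card_fiber {ι : Type*} [Fintype ι] (d : ι → ℕ) (b : ℕ → ℕ)
    (hb : ∀ j, b j = Fintype.card {t // d t = j}) :
    ∃ e : (Σ j, Fin (b j)) ≃ ι, ∀ p, d (e p) = p.1 := by
  refine ⟨(Equiv.sigmaCongrRight fun j => (finCongr (hb j)).trans
    (Fintype.equivFin {t // d t = j}).symm).trans (Equiv.sigmaFiberEquiv d), fun p => ?_⟩
  simpa using ((Fintype.equivFin {t // d t = p.1}).symm (finCongr (hb p.1) p.2)).2

variable {K : Type*} [Field K] {n : ℕ}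

theorem degree_add_eq_of_mem_support_mul {f g : MvPolynomial (Fin n) K} {a b e : ℕ}
    (hab : b < a) (hf : f.IsHomogeneous (a - b)) (hg : ∀ m ∈ g.support, m.degree + a = e) :
    ∀ m ∈ (f * g).support, m.degree + b = e := by
  classical
  intro m hm
  obtain ⟨m₁, h₁, m₂, h₂, rfl⟩ := Finset.mem_add.mp (support_mul f g hm)
  have h1 : m₁.degree = a - b := by
    by_contra h
    exact mem_support_iff.mp h₁ (hf.coeff_eq_zero h)
  have h2 := hg m₂ h₂
  rw [map_add]
  omega

theorem mem_span_X_of_isHomogeneous {f : MvPolynomial (Fin n) K} {a : ℕ} (ha : 0 < a)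
    (hf : f.IsHomogeneous a) :
    f ∈ Ideal.span (Set.range (X : Fin n → MvPolynomial (Fin n) K)) := by
  rw [← Set.image_univ, mem_ideal_span_X_image]
  intro m hm
  by_contra! h
  have : m = 0 := Finsupp.ext fun i => h i (Set.mem_univ i)
  subst this
  exact mem_support_iff.mp hm (hf.coeff_eq_zero (by simpa using ha.ne))

/-- Homogeneity of the entries makes the maps graded. The strict inequality of degrees, imposed also
where an entry is zero, puts each entry in the ideal of the variables, which is minimality. -/
theorem nonempty_minimalGradedFreeResolution_of_matrices (I : Ideal (MvPolynomial (Fin n) K))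
    (β : ℕ → ℕ → ℕ) (r : ℕ → ℕ) (d : ∀ i, Fin (r i) → ℕ)
    (hβ : ∀ i j, β i j = Fintype.card {t // d i t = j})
    (D : ∀ i, Matrix (Fin (r i)) (Fin (r (i + 1))) (MvPolynomial (Fin n) K))
    (hD : ∀ i s t, d i s < d (i + 1) t ∧ (D i s t).IsHomogeneous (d (i + 1) t - d i s))
    (o : Fin (r 0)) (ho : d 0 o = 0)
    (hexact₀ : ∀ v : Fin (r 0) → MvPolynomial (Fin n) K,
      v o ∈ I ↔ ∃ w, (D 0).mulVec w = v)
    (hexact : ∀ i (v : Fin (r (i + 1)) → MvPolynomial (Fin n) K),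
      (D i).mulVec v = 0 ↔ ∃ w, (D (i + 1)).mulVec w = v) :
    Nonempty (MinimalGradedFreeResolution (n := n) (M := MvPolynomial (Fin n) K ⧸ I)
      (fun e => (homogeneousSubmodule (Fin n) K e).map (Ideal.Quotient.mkₐ K I).toLinearMap) β) := by
  classical
  choose e he using fun i => exists_sigma_equiv_of_card_fiber (d i) (β i) (hβ i)
  let Φ : ∀ i, GradedFree K n (β i) ≃ₗ[MvPolynomial (Fin n) K]
      (Fin (r i) → MvPolynomial (Fin n) K) := fun i =>
    (Finsupp.domLCongr (e i)).trans (Finsupp.linearEquivFunOnFinite _ _ _)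
  have hΦ : ∀ i v s, Φ i v s = v ((e i).symm s) := fun i v s => by simp [Φ]
  have hΦsymm : ∀ i v p, (Φ i).symm v p = v (e i p) := fun i v p => by simp [Φ]
  have hentry : ∀ i (v : GradedFree K n (β (i + 1))) p,
      (Φ i).symm ((D i).mulVec (Φ (i + 1) v)) p = ∑ t, D i (e i p) t * v ((e (i + 1)).symm t) := by
    intro i v p
    rw [hΦsymm]
    simp [Matrix.mulVec, dotProduct, hΦ]
  refine ⟨{
    aug := (Submodule.mkQ I).comp ((LinearMap.proj o).comp (Φ 0).toLinearMap)
    diff := fun i => (Φ i).symm.toLinearMap.comp ((D i).mulVecLin.comp (Φ (i + 1)).toLinearMap)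
    aug_homogeneous := ?_
    diff_homogeneous := ?_
    aug_surjective := ?_
    exact_zero := ?_
    exact_succ := ?_
    minimal := ?_ }⟩
  · intro v k hv
    refine Submodule.mem_map.mpr ⟨Φ 0 v o, ?_, rfl⟩
    rw [mem_homogeneousSubmodule, hΦ]
    intro m hm
    have h := hv ((e 0).symm o) m (mem_support_iff.mpr hm)
    rw [← he 0, Equiv.apply_symm_apply, ho, add_zero] at h
    rwa [Finsupp.degree_eq_weight_one] at h
  · intro i v k hv p m hm
    change m ∈ ((Φ i).symm ((D i).mulVec (Φ (i + 1) v)) p).support at hm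
    rw [hentry] at hm
    obtain ⟨t, -, ht⟩ := Finset.mem_biUnion.mp (support_sum hm)
    rw [← he i p]
    refine degree_add_eq_of_mem_support_mul (hD i _ t).1 (hD i _ t).2 ?_ m ht
    intro m' hm'
    have := hv _ m' hm'
    rwa [← he (i + 1), Equiv.apply_symm_apply] at this
  · intro x
    obtain ⟨f, rfl⟩ := Submodule.mkQ_surjective I x
    exact ⟨(Φ 0).symm (fun _ => f), by simp⟩
  · intro v
    have h := hexact₀ (Φ 0 v)
    rw [← Submodule.Quotient.mk_eq_zero] at h
    refine h.trans ⟨?_, ?_⟩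
    · rintro ⟨w, hw⟩
      exact ⟨(Φ 1).symm w, (Φ 0).injective (by simpa using hw)⟩
    · rintro ⟨w, rfl⟩
      exact ⟨Φ 1 w, by simp⟩
  · intro i v
    have h := hexact i (Φ (i + 1) v)
    refine Iff.trans ?_ (h.trans ⟨?_, ?_⟩)
    · simp
    · rintro ⟨w, hw⟩
      exact ⟨(Φ (i + 2)).symm w, (Φ (i + 1)).injective (by simpa using hw)⟩
    · rintro ⟨w, rfl⟩
      exact ⟨Φ (i + 2) w, by simp⟩
  · rintro i _ ⟨v, rfl⟩
    change (Φ i).symm ((D i).mulVec (Φ (i + 1) v)) ∈ _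
    set w := (Φ i).symm ((D i).mulVec (Φ (i + 1) v)) with hw
    rw [← Finsupp.sum_single w]
    refine Submodule.sum_mem _ fun p _ => ?_
    have : Finsupp.single p (w p) = w p • Finsupp.single p (1 : MvPolynomial (Fin n) K) := by simp
    simp only [this]
    refine Submodule.smul_mem_smul ?_ Submodule.mem_top
    rw [hw, hentry]
    exact Ideal.sum_mem _ fun t _ => Ideal.mul_mem_right _ _
      (mem_span_X_of_isHomogeneous (Nat.sub_pos_of_lt (hD i _ t).1) (hD i _ t).2)

end MatrixResolution

/-! ### Maximal minors of a `2 × 3` matrix, and one further quadric -/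

section HilbertBurch

/-- The maximal minors of the `2 × 3` matrix with rows `a` and `b`, with alternating signs. -/
def signedMinors {S : Type*} [CommRing S] (a b : Fin 3 → S) : Fin 3 → S :=
  ![a 1 * b 2 - a 2 * b 1, a 2 * b 0 - a 0 * b 2, a 0 * b 1 - a 1 * b 0]

variable {S : Type*} [CommRing S] [IsDomain S] {a b : Fin 3 → S}

theorem eq_zero_of_smul_add_smul_eq_zero (h : signedMinors a b ≠ 0) {α β : S}
    (h0 : ∀ i, α * a i + β * b i = 0) : α = 0 ∧ β = 0 := by
  have key : ∀ i j, α * (a i * b j - a j * b i) = 0 ∧ β * (a i * b j - a j * b i) = 0 := fun i j =>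
    ⟨by linear_combination b j * h0 i - b i * h0 j, by linear_combination a i * h0 j - a j * h0 i⟩
  simp only [mul_eq_zero] at key
  by_contra hne
  have : ∀ i j, a i * b j - a j * b i = 0 := fun i j => by
    by_contra hij
    exact hne ⟨(key i j).1.resolve_right hij, (key i j).2.resolve_right hij⟩
  refine h (funext fun i => ?_)
  fin_cases i <;> simp [signedMinors, this]

/-- Hilbert–Burch exactness by hand. The vectors `a`, `b`, `f` are all orthogonal to `m = a × b`, so
`a × f` and `b × f` are proportional to `m`. As `m 0` is prime and does not divide `m 1`, it divides
the first coordinates of both; the quotients are, up to sign, the coefficients given by Cramer's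
rule. -/
theorem exists_smul_add_smul_of_sum_signedMinors_eq_zero
    (hp : Prime (signedMinors a b 0)) (h01 : ¬ signedMinors a b 0 ∣ signedMinors a b 1)
    {f : Fin 3 → S} (hf : ∑ i, signedMinors a b i * f i = 0) :
    ∃ α β : S, ∀ i, α * a i + β * b i = f i := by
  simp only [Fin.sum_univ_three] at hf
  set m := signedMinors a b with hm
  have h0 : m 0 = a 1 * b 2 - a 2 * b 1 := rfl
  have h1 : m 1 = a 2 * b 0 - a 0 * b 2 := rfl
  have h2 : m 2 = a 0 * b 1 - a 1 * b 0 := rfl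
  have hne := hp.ne_zero
  -- the vector `a × f` is a multiple of `a × b`
  have key : ∀ c : Fin 3 → S, m 0 * (c 2 * f 0 - c 0 * f 2) = m 1 * (c 1 * f 2 - c 2 * f 1) →
      ∃ β, c 1 * f 2 - c 2 * f 1 = m 0 * β := fun c hc =>
    ((hp.dvd_or_dvd (Dvd.intro _ hc)).resolve_left h01)
  have hf' := hf
  rw [h0, h1, h2] at hf'
  obtain ⟨β, hβ⟩ := key a (by
    linear_combination a 2 * hf' + (a 2 * f 0 - a 0 * f 2) * h0 - (a 1 * f 2 - a 2 * f 1) * h1)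
  obtain ⟨α, hα⟩ := key b (by
    linear_combination b 2 * hf' + (b 2 * f 0 - b 0 * f 2) * h0 - (b 1 * f 2 - b 2 * f 1) * h1)
  refine ⟨-α, β, ?_⟩
  have e1 : -α * a 1 + β * b 1 = f 1 := by
    refine mul_left_cancel₀ hne ?_
    linear_combination a 1 * hα - b 1 * hβ - f 1 * h0
  have e2 : -α * a 2 + β * b 2 = f 2 := by
    refine mul_left_cancel₀ hne ?_
    linear_combination a 2 * hα - b 2 * hβ - f 2 * h0
  have e0 : -α * a 0 + β * b 0 = f 0 := by
    refine mul_left_cancel₀ hne ?_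
    linear_combination a 0 * hα - b 0 * hβ - hf' - f 0 * h0
  intro i
  fin_cases i
  exacts [e0, e1, e2]

end HilbertBurch

/-! ### The resolution of the ideal of a quadric and three minors -/

section QuadricResolution

open MvPolynomial

/-- The ranks of the free modules in `0 → S² → S⁵ → S⁴ → S`. -/
def quadricRank : ℕ → ℕ
  | 0 => 1
  | 1 => 4
  | 2 => 5
  | 3 => 2
  | _ => 0

/-- The degrees of the basis elements in
`0 → S(-5)² → S(-3)² ⊕ S(-4)³ → S(-2)⁴ → S`. -/
def quadricDegree : ∀ i, Fin (quadricRank i) → ℕ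
  | 0 => ![0]
  | 1 => ![2, 2, 2, 2]
  | 2 => ![3, 3, 4, 4, 4]
  | 3 => ![5, 5]
  | _ + 4 => fun _ => 0

section Matrices

variable {S : Type*} [CommRing S] (a b : Fin 3 → S) (q : S)

/-- The generators: the quadric and the minors. -/
def quadricGenerators : Matrix (Fin 1) (Fin 4) S :=
  !![q, signedMinors a b 0, signedMinors a b 1, signedMinors a b 2]

/-- The first syzygies of the quadric and the minors. -/
def quadricSyzygies : Matrix (Fin 4) (Fin 5) S :=
  !![0, 0, signedMinors a b 0, signedMinors a b 1, signedMinors a b 2;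
     a 0, b 0, -q, 0, 0;
     a 1, b 1, 0, -q, 0;
     a 2, b 2, 0, 0, -q]

/-- The second syzygies of the quadric and the minors. -/
def quadricSecondSyzygies : Matrix (Fin 5) (Fin 2) S :=
  !![q, 0; 0, q; a 0, b 0; a 1, b 1; a 2, b 2]

/-- The differentials: the tensor product of the Hilbert–Burch complex of the matrix with rows `a`
and `b` with the Koszul complex of `q`. -/
def quadricMatrix : ∀ i, Matrix (Fin (quadricRank i)) (Fin (quadricRank (i + 1))) S
  | 0 => quadricGenerators a b q
  | 1 => quadricSyzygies a b q
  | 2 => quadricSecondSyzygies a b q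
  | _ + 3 => 0

end Matrices

theorem commonBettiTable_eq_card (i j : ℕ) :
    commonBettiTable i j = Fintype.card {t // quadricDegree i t = j} := by
  -- All degrees are at most 5, so beyond that the fibres are empty and only finitely many cases are
  -- left to evaluate.
  have big : ∀ i, (∀ t, quadricDegree i t < 6) → 6 ≤ j →
      Fintype.card {t // quadricDegree i t = j} = 0 := fun i h hj => by
    rw [Fintype.card_eq_zero_iff]
    exact ⟨fun t => by have := h t.1; have := t.2; omega⟩
  match i with
  | 0 | 1 | 2 | 3 =>
    by_cases hj : j < 6
    · interval_cases j <;> decide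
    · rw [big _ (by decide) (by omega)]
      simp only [commonBettiTable]
      split <;> first | rfl | omega
  | i + 4 =>
    rw [Fintype.card_eq_zero_iff.mpr ⟨fun t => t.1.elim0⟩]
    rfl

/-! ### Exactness of the tensor product complex -/

section Exact

variable {S : Type*} [CommRing S] {a b : Fin 3 → S} {q : S}

theorem quadricGenerators_mulVec (v : Fin 4 → S) :
    (quadricGenerators a b q).mulVec v =
      ![q * v 0 + signedMinors a b 0 * v 1 + signedMinors a b 1 * v 2 +
        signedMinors a b 2 * v 3] := by
  funext i
  fin_cases i
  simp [quadricGenerators, Matrix.mulVec, dotProduct, Fin.sum_univ_four]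

theorem quadricSyzygies_mulVec (v : Fin 5 → S) :
    (quadricSyzygies a b q).mulVec v =
      ![signedMinors a b 0 * v 2 + signedMinors a b 1 * v 3 + signedMinors a b 2 * v 4,
        a 0 * v 0 + b 0 * v 1 - q * v 2, a 1 * v 0 + b 1 * v 1 - q * v 3,
        a 2 * v 0 + b 2 * v 1 - q * v 4] := by
  funext i
  fin_cases i <;>
    simp [quadricSyzygies, Matrix.mulVec, dotProduct, Fin.sum_univ_five] <;> ring

theorem quadricSecondSyzygies_mulVec (v : Fin 2 → S) :
    (quadricSecondSyzygies a b q).mulVec v =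
      ![q * v 0, q * v 1, a 0 * v 0 + b 0 * v 1, a 1 * v 0 + b 1 * v 1, a 2 * v 0 + b 2 * v 1] := by
  funext i
  fin_cases i <;>
    simp [quadricSecondSyzygies, Matrix.mulVec, dotProduct, Fin.sum_univ_two]

theorem mem_sup_iff_exists_mulVec (a b : Fin 3 → S) (q : S) (v : Fin 1 → S) :
    v 0 ∈ Ideal.span {q} ⊔ Ideal.span (Set.range (signedMinors a b)) ↔
      ∃ w, (quadricGenerators a b q).mulVec w = v := by
  rw [Submodule.mem_sup]
  constructor
  · rintro ⟨y, hy, z, hz, hyz⟩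
    obtain ⟨c, rfl⟩ := Ideal.mem_span_singleton'.mp hy
    obtain ⟨d, rfl⟩ := Ideal.mem_span_range_iff_exists_fun.mp hz
    refine ⟨![c, d 0, d 1, d 2], ?_⟩
    rw [quadricGenerators_mulVec]
    funext i
    fin_cases i
    simp only [Matrix.cons_val, Fin.sum_univ_three, Fin.zero_eta, ← hyz]
    ring
  · rintro ⟨w, rfl⟩
    refine ⟨w 0 * q, Ideal.mem_span_singleton'.mpr ⟨_, rfl⟩, _,
      Ideal.mem_span_range_iff_exists_fun.mpr ⟨![w 1, w 2, w 3], rfl⟩, ?_⟩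
    rw [quadricGenerators_mulVec]
    simp only [Matrix.cons_val, Fin.sum_univ_three]
    ring

theorem sum_signedMinors_mul_add (a b : Fin 3 → S) (α β : S) :
    ∑ i, signedMinors a b i * (α * a i + β * b i) = 0 := by
  simp only [Fin.sum_univ_three, signedMinors, Matrix.cons_val]
  ring

variable [IsDomain S] (hp : Prime (signedMinors a b 0))
  (h01 : ¬ signedMinors a b 0 ∣ signedMinors a b 1)
  (hJ : (Ideal.span (Set.range (signedMinors a b))).IsPrime)
  (hq : q ∉ Ideal.span (Set.range (signedMinors a b)))

include hp h01 hJ hq in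
-- In a syzygy, `q * v 0` lies in the prime `J` while `q` does not, so `v 0` is a combination of the
-- minors. Subtracting the corresponding Koszul syzygies leaves a syzygy of the minors alone, to
-- which Hilbert–Burch applies.
theorem quadricGenerators_mulVec_eq_zero_iff (v : Fin 4 → S) :
    (quadricGenerators a b q).mulVec v = 0 ↔ ∃ w, (quadricSyzygies a b q).mulVec w = v := by
  constructor
  · intro h
    rw [quadricGenerators_mulVec] at h
    have h : q * v 0 + signedMinors a b 0 * v 1 + signedMinors a b 1 * v 2 +
      signedMinors a b 2 * v 3 = 0 := congrFun h (0 : Fin 1)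
    have hmem : q * v 0 ∈ Ideal.span (Set.range (signedMinors a b)) := by
      rw [Ideal.mem_span_range_iff_exists_fun]
      exact ⟨![-v 1, -v 2, -v 3], by
        simp only [Fin.sum_univ_three, Matrix.cons_val]
        linear_combination -h⟩
    obtain ⟨c, hc⟩ := (Ideal.mem_span_range_iff_exists_fun).mp ((hJ.mem_or_mem hmem).resolve_left hq)
    obtain ⟨α, β, hαβ⟩ := exists_smul_add_smul_of_sum_signedMinors_eq_zero hp h01
      (f := ![v 1 + q * c 0, v 2 + q * c 1, v 3 + q * c 2]) (by
        simp only [Fin.sum_univ_three, Matrix.cons_val] at hc ⊢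
        linear_combination h + q * hc)
    have e0 := hαβ 0
    have e1 := hαβ 1
    have e2 := hαβ 2
    simp only [Fin.sum_univ_three, Matrix.cons_val] at hc e0 e1 e2
    refine ⟨![α, β, c 0, c 1, c 2], ?_⟩
    rw [quadricSyzygies_mulVec]
    funext i
    fin_cases i
    · simpa [mul_comm] using hc
    · change a 0 * α + b 0 * β - q * c 0 = v 1
      linear_combination e0
    · change a 1 * α + b 1 * β - q * c 1 = v 2
      linear_combination e1
    · change a 2 * α + b 2 * β - q * c 2 = v 3
      linear_combination e2
  · rintro ⟨w, rfl⟩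
    have := sum_signedMinors_mul_add a b (w 0) (w 1)
    rw [Fin.sum_univ_three] at this
    rw [quadricSyzygies_mulVec, quadricGenerators_mulVec]
    funext i
    fin_cases i
    simp only [Matrix.cons_val, Fin.zero_eta, Pi.zero_apply]
    linear_combination this

include hp h01 in
-- The first row says that the last three coordinates form a syzygy of the minors, hence equal `α a
-- + β b`. The other rows then give a relation between `a` and `b` with coefficients `v 0 - q α` and
-- `v 1 - q β`, which must vanish.
theorem quadricSyzygies_mulVec_eq_zero_iff (v : Fin 5 → S) :
    (quadricSyzygies a b q).mulVec v = 0 ↔ ∃ w, (quadricSecondSyzygies a b q).mulVec w = v := by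
  constructor
  · intro h
    rw [quadricSyzygies_mulVec] at h
    have h0 : signedMinors a b 0 * v 2 + signedMinors a b 1 * v 3 + signedMinors a b 2 * v 4 = 0 :=
      congrFun h (0 : Fin 4)
    have h1 : a 0 * v 0 + b 0 * v 1 - q * v 2 = 0 := congrFun h (1 : Fin 4)
    have h2 : a 1 * v 0 + b 1 * v 1 - q * v 3 = 0 := congrFun h (2 : Fin 4)
    have h3 : a 2 * v 0 + b 2 * v 1 - q * v 4 = 0 := congrFun h (3 : Fin 4)
    obtain ⟨α, β, hαβ⟩ := exists_smul_add_smul_of_sum_signedMinors_eq_zero hp h01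
      (f := ![v 2, v 3, v 4]) (by simpa [Fin.sum_univ_three] using h0)
    have e0 := hαβ 0
    have e1 := hαβ 1
    have e2 := hαβ 2
    simp only [Matrix.cons_val] at e0 e1 e2
    have key := eq_zero_of_smul_add_smul_eq_zero (a := a) (b := b)
      (fun h => hp.ne_zero (congrFun h 0)) (α := v 0 - q * α) (β := v 1 - q * β) (fun i => by
        fin_cases i
        · simp only [Fin.zero_eta]
          linear_combination h1 - q * e0
        · simp only [Fin.mk_one]
          linear_combination h2 - q * e1
        · simp only [Fin.reduceFinMk]
          linear_combination h3 - q * e2)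
    refine ⟨![α, β], ?_⟩
    rw [quadricSecondSyzygies_mulVec]
    funext i
    fin_cases i
    · change q * α = v 0
      linear_combination -key.1
    · change q * β = v 1
      linear_combination -key.2
    · change a 0 * α + b 0 * β = v 2
      linear_combination e0
    · change a 1 * α + b 1 * β = v 3
      linear_combination e1
    · change a 2 * α + b 2 * β = v 4
      linear_combination e2
  · rintro ⟨w, rfl⟩
    have := sum_signedMinors_mul_add a b (w 0) (w 1)
    rw [Fin.sum_univ_three] at this
    rw [quadricSecondSyzygies_mulVec, quadricSyzygies_mulVec]
    funext i
    fin_cases i <;>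
      simp only [Matrix.cons_val, Fin.zero_eta, Fin.mk_one, Fin.reduceFinMk, Pi.zero_apply]
    · linear_combination this
    all_goals ring

include hq in
theorem quadricSecondSyzygies_mulVec_eq_zero_iff (v : Fin 2 → S) :
    (quadricSecondSyzygies a b q).mulVec v = 0 ↔ v = 0 := by
  have hq0 : q ≠ 0 := fun h => hq (h ▸ Ideal.zero_mem _)
  refine ⟨fun h => ?_, fun h => by rw [h, Matrix.mulVec_zero]⟩
  rw [quadricSecondSyzygies_mulVec] at h
  have h0 : q * v 0 = 0 := congrFun h (0 : Fin 5)
  have h1 : q * v 1 = 0 := congrFun h (1 : Fin 5)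
  funext i
  fin_cases i
  · simpa [hq0] using h0
  · simpa [hq0] using h1

end Exact

theorem nonempty_resolution_of_quadric_of_signedMinors {K : Type*} [Field K] {n : ℕ}
    {a b : Fin 3 → MvPolynomial (Fin n) K} {q : MvPolynomial (Fin n) K}
    (ha : ∀ i, (a i).IsHomogeneous 1) (hb : ∀ i, (b i).IsHomogeneous 1) (hq2 : q.IsHomogeneous 2)
    (hp : Prime (signedMinors a b 0)) (h01 : ¬ signedMinors a b 0 ∣ signedMinors a b 1)
    (hJ : (Ideal.span (Set.range (signedMinors a b))).IsPrime)
    (hq : q ∉ Ideal.span (Set.range (signedMinors a b))) :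
    Nonempty (MinimalGradedFreeResolution (n := n)
      (M := MvPolynomial (Fin n) K ⧸ (Ideal.span {q} ⊔ Ideal.span (Set.range (signedMinors a b))))
      (fun e => (homogeneousSubmodule (Fin n) K e).map (Ideal.Quotient.mkₐ K _).toLinearMap)
      commonBettiTable) := by
  have hm : ∀ i, (signedMinors a b i).IsHomogeneous 2 := by
    intro i
    fin_cases i <;>
      exact ((ha _).mul (hb _)).sub ((ha _).mul (hb _))
  have h0 : ∀ k, (0 : MvPolynomial (Fin n) K).IsHomogeneous k := isHomogeneous_zero _ _
  refine nonempty_minimalGradedFreeResolution_of_matrices _ commonBettiTable quadricRank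
    quadricDegree commonBettiTable_eq_card (quadricMatrix a b q) ?_ (0 : Fin 1) rfl ?_ ?_
  · intro i
    match i with
    | 0 =>
      intro (s : Fin 1) (t : Fin 4)
      fin_cases s; fin_cases t
      exacts [⟨by decide, hq2⟩, ⟨by decide, hm 0⟩, ⟨by decide, hm 1⟩, ⟨by decide, hm 2⟩]
    | 1 =>
      intro (s : Fin 4) (t : Fin 5)
      fin_cases s <;> fin_cases t <;> refine ⟨by decide, ?_⟩
      exacts [h0 _, h0 _, hm 0, hm 1, hm 2, ha 0, hb 0, hq2.neg, h0 _, h0 _,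
        ha 1, hb 1, h0 _, hq2.neg, h0 _, ha 2, hb 2, h0 _, h0 _, hq2.neg]
    | 2 =>
      intro (s : Fin 5) (t : Fin 2)
      fin_cases s <;> fin_cases t <;> refine ⟨by decide, ?_⟩
      exacts [hq2, h0 _, h0 _, hq2, ha 0, hb 0, ha 1, hb 1, ha 2, hb 2]
    | i + 3 => exact fun s (t : Fin 0) => t.elim0
  · exact mem_sup_iff_exists_mulVec a b q
  · intro i
    match i with
    | 0 => exact quadricGenerators_mulVec_eq_zero_iff hp h01 hJ hq
    | 1 => exact quadricSyzygies_mulVec_eq_zero_iff hp h01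
    | 2 =>
      refine fun v => (quadricSecondSyzygies_mulVec_eq_zero_iff hq v).trans
        ⟨fun h => ⟨0, (Matrix.mulVec_zero _).trans h.symm⟩, ?_⟩
      rintro ⟨w, rfl⟩
      exact Matrix.zero_mulVec w
    | i + 3 =>
      exact fun v => ⟨fun _ => ⟨0, funext fun t : Fin 0 => t.elim0⟩,
        fun _ => Matrix.zero_mulVec v⟩

end QuadricResolution

/-! ### Kernels of maps to function fields -/

section Kernels

open MvPolynomial

/-- `ψ` is injective on the subalgebra `A` and maps it into the field `F`. -/
def EmbedsInto {K R L : Type*} [Field K] [CommRing R] [Algebra K R] [Field L] [Algebra K L]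
    (ψ : R →ₐ[K] L) (A : Subalgebra K R) (F : IntermediateField K L) : Prop :=
  (∀ a ∈ A, ψ a = 0 → a = 0) ∧ ∀ a ∈ A, ψ a ∈ F

variable {K R L : Type*} [Field K] [CommRing R] [Algebra K R] [Field L] [Algebra K L]
  {ψ : R →ₐ[K] L}

theorem embedsInto_bot {κ : Type*} (x : κ → L) :
    EmbedsInto ψ ⊥ (IntermediateField.adjoin K (x '' ∅)) := by
  refine ⟨fun a ha h => ?_, fun a ha => ?_⟩ <;> obtain ⟨k, rfl⟩ := Algebra.mem_bot.mp ha
  · rw [AlgHom.commutes, map_eq_zero] at h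
    rw [h, map_zero]
  · rw [AlgHom.commutes]
    exact IntermediateField.algebraMap_mem _ _

/-- The inductive step of the tower: one new independent variable `x k` enters, together with all
generators having a pole in it. Conditions on pairs are asked only for `i < j`; they are symmetric,
and this halves the cases in applications. -/
theorem EmbedsInto.adjoin_simple_poles {κ : Type*} {x : κ → L} (hx : AlgebraicIndependent K x)
    {A : Subalgebra K R} {s : Set κ} (h : EmbedsInto ψ A (IntermediateField.adjoin K (x '' s)))
    {k : κ} (hk : k ∉ s) {r : ℕ} (u : Fin r → R) (c f : Fin r → L)
    (hc : ∀ i j, i < j → c i ≠ c j) (hcF : ∀ i, c i ∈ IntermediateField.adjoin K (x '' s))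
    (hfF : ∀ i, f i ∈ IntermediateField.adjoin K (x '' s)) (hf : ∀ i, f i ≠ 0)
    (hu : ∀ i, ψ (u i) = f i * (x k - c i)⁻¹)
    (hrel : ∀ i j, i < j → ∃ a ∈ A, ∃ b ∈ A, u i * u j = a * u i + b * u j) :
    EmbedsInto ψ (Algebra.adjoin K ((A : Set R) ∪ Set.range u))
      (IntermediateField.adjoin K (x '' insert k s)) := by
  have hle : IntermediateField.adjoin K (x '' s) ≤ IntermediateField.adjoin K (x '' insert k s) :=
    IntermediateField.adjoin.mono _ _ _ (Set.image_mono (Set.subset_insert k s))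
  have hrel' : ∀ i j, i ≠ j → ∃ a ∈ A, ∃ b ∈ A, u i * u j = a * u i + b * u j := by
    intro i j hij
    rcases lt_or_gt_of_ne hij with h | h
    · exact hrel i j h
    · obtain ⟨a, ha, b, hb, h⟩ := hrel j i h
      exact ⟨b, hb, a, ha, by rw [mul_comm, h, add_comm]⟩
  have hc' : Function.Injective c := by
    intro i j hij
    by_contra hne
    rcases lt_or_gt_of_ne hne with h | h
    exacts [hc i j h hij, hc j i h hij.symm]
  refine ⟨eq_zero_of_mem_adjoin_simple_poles ψ A h.1 _ h.2
    (IntermediateField.transcendental_adjoin_iff.mpr (hx.transcendental_adjoin hk))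
    u c f hc' hcF hfF hf hu hrel', fun a ha => ?_⟩
  induction ha using Algebra.adjoin_induction with
  | mem y hy =>
    rcases hy with hy | ⟨i, rfl⟩
    · exact hle (h.2 y hy)
    · rw [hu i]
      exact mul_mem (hle (hfF i)) (inv_mem (sub_mem
        (IntermediateField.subset_adjoin _ _ ⟨k, Set.mem_insert _ _, rfl⟩) (hle (hcF i))))
  | algebraMap r =>
    rw [AlgHom.commutes]
    exact IntermediateField.algebraMap_mem _ _
  | add _ _ _ _ h₁ h₂ => rw [map_add]; exact add_mem h₁ h₂
  | mul _ _ _ _ h₁ h₂ => rw [map_mul]; exact mul_mem h₁ h₂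

/-- The case of one pole: adjoining a transcendental element. -/
theorem EmbedsInto.adjoin_simple_pole {κ : Type*} {x : κ → L} (hx : AlgebraicIndependent K x)
    {A : Subalgebra K R} {s : Set κ} (h : EmbedsInto ψ A (IntermediateField.adjoin K (x '' s)))
    {k : κ} (hk : k ∉ s) (u : R) (hu : ψ u = (x k)⁻¹) :
    EmbedsInto ψ (Algebra.adjoin K ((A : Set R) ∪ Set.range ![u]))
      (IntermediateField.adjoin K (x '' insert k s)) :=
  h.adjoin_simple_poles hx hk ![u] 0 1 (fun i j hij => absurd (Subsingleton.elim i j) hij.ne)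
    (fun _ => zero_mem _) (fun _ => one_mem _) (fun _ => one_ne_zero)
    (fun i => by fin_cases i; simpa using hu)
    (fun i j hij => absurd (Subsingleton.elim i j) hij.ne)

theorem mem_adjoin_union_left {A : Subalgebra K R} {T : Set R} {y : R} (hy : y ∈ A) :
    y ∈ Algebra.adjoin K ((A : Set R) ∪ T) :=
  Algebra.subset_adjoin (Or.inl hy)

theorem mem_adjoin_union_range {A : Subalgebra K R} {ι : Type*} (u : ι → R) (i : ι) :
    u i ∈ Algebra.adjoin K ((A : Set R) ∪ Set.range u) :=
  Algebra.subset_adjoin (Or.inr ⟨i, rfl⟩)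

theorem ker_eq_of_embedsInto {n : ℕ} {φ : MvPolynomial (Fin n) K →ₐ[K] L}
    {I : Ideal (MvPolynomial (Fin n) K)} (hI : ∀ p ∈ I, φ p = 0)
    {B : Subalgebra K (MvPolynomial (Fin n) K ⧸ I)} {F : IntermediateField K L}
    (h : EmbedsInto (Ideal.Quotient.liftₐ I φ hI) B F)
    (hB : ∀ i, Ideal.Quotient.mk I (X i) ∈ B) : RingHom.ker φ = I := by
  refine le_antisymm (fun p hp => ?_) fun p hp => hI p hp
  have hmem : Ideal.Quotient.mkₐ K I p ∈ B := by
    have : (⊤ : Subalgebra K (MvPolynomial (Fin n) K)) ≤ B.comap (Ideal.Quotient.mkₐ K I) := by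
      rw [← adjoin_range_X, Algebra.adjoin_le_iff]
      rintro _ ⟨i, rfl⟩
      exact hB i
    exact this Algebra.mem_top
  rw [← Ideal.Quotient.eq_zero_iff_mem]
  exact h.1 _ hmem (show φ p = 0 from hp)

theorem algebraicIndependent_fractionRing_X (K : Type*) [Field K] (n : ℕ) :
    AlgebraicIndependent K fun i : Fin n => algebraMap (MvPolynomial (Fin n) K)
      (FractionRing (MvPolynomial (Fin n) K)) (X i) :=
  (algebraicIndependent_X (Fin n) K).map' (f := IsScalarTower.toAlgHom K _ _)
    (IsFractionRing.injective _ _)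

theorem AlgebraicIndependent.aeval_ne_zero_of_eval {κ : Type*} {x : κ → L}
    (hx : AlgebraicIndependent K x) {p : MvPolynomial κ K} (v : κ → K) (hv : eval v p ≠ 0) :
    aeval x p ≠ 0 := by
  rw [Ne, map_eq_zero_iff _ hx]
  rintro rfl
  exact hv (map_zero _)

end Kernels

/-! ### Irreducible and coprime forms; resolutions of equal ideals -/

section Quadrics

open MvPolynomial

variable {K : Type*} [Field K] {n : ℕ}

theorem irreducible_of_isHomogeneous_one {f : MvPolynomial (Fin n) K} (hf : f.IsHomogeneous 1)
    (h0 : f ≠ 0) : Irreducible f := by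
  refine irreducible_of_totalDegree_eq_one (hf.totalDegree h0) fun c hc => ?_
  rw [isUnit_iff_ne_zero]
  rintro rfl
  exact h0 (MvPolynomial.ext _ _ fun m => by simpa using hc m)

theorem isRelPrime_of_irreducible_of_eval {f g : MvPolynomial (Fin n) K} (hf : Irreducible f)
    (v : Fin n → K) (hfv : eval v f = 0) (hgv : eval v g ≠ 0) : IsRelPrime f g := by
  refine (hf.dvd_or_isRelPrime (n := g)).resolve_left ?_
  rintro ⟨c, rfl⟩
  simp [hfv] at hgv

theorem isOrlikTeraoBetti_of_ideal_eq {k : ℕ} {ℓ : Fin n → MvPolynomial (Fin k) K}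
    {I : Ideal (MvPolynomial (Fin n) K)} (hI : orlikTeraoIdeal ℓ = I) {β : ℕ → ℕ → ℕ}
    (h : Nonempty (MinimalGradedFreeResolution (n := n) (M := MvPolynomial (Fin n) K ⧸ I)
      (fun e => (homogeneousSubmodule (Fin n) K e).map (Ideal.Quotient.mkₐ K I).toLinearMap) β)) :
    IsOrlikTeraoBetti ℓ β := by
  subst hI
  exact h

end Quadrics

/-! ### The braid arrangement `x, y, z, x - y, x - z, y - z` -/

section Braid

open MvPolynomial

variable (K : Type*) [Field K]

/-- The first row of the `2 × 3` matrix for the braid arrangement. -/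
noncomputable def braidRow₁ : Fin 3 → MvPolynomial (Fin 6) K :=
  ![X 5 - X 1, X 0 - X 4, X 0 - X 1]

/-- The second row of the `2 × 3` matrix for the braid arrangement. -/
noncomputable def braidRow₂ : Fin 3 → MvPolynomial (Fin 6) K :=
  ![X 5 + X 3, X 0 - X 3, X 0 - X 2]

/-- The quadric relation of `x, y, x - y`. -/
noncomputable def braidQuadric : MvPolynomial (Fin 6) K :=
  X 0 * X 1 - X 3 * (X 1 - X 0)

/-- The linear forms of the braid arrangement. -/
noncomputable def braidForms : Fin 6 → MvPolynomial (Fin 3) K :=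
  ![X 0, X 1, X 2, X 0 - X 1, X 0 - X 2, X 1 - X 2]

/-- This minor has degree one in `X 2`, so it is irreducible once its two coefficients are coprime.
-/
theorem prime_signedMinors_braid : Prime (signedMinors (braidRow₁ K) (braidRow₂ K) 0) := by
  have h : signedMinors (braidRow₁ K) (braidRow₂ K) 0 = (X 4 - X 0) * X 2 +
      (X 0 * X 3 + X 0 * X 1 - X 1 * X 3 - X 0 * X 4) := by
    simp only [signedMinors, braidRow₁, braidRow₂, Matrix.cons_val]
    ring
  have hX : ∀ j : Fin 6, j ≠ 2 → (X j : MvPolynomial (Fin 6) K) ∈ supported K {2}ᶜ :=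
    fun j hj => X_mem_supported.mpr hj
  have hvars : ∀ f ∈ supported K {(2 : Fin 6)}ᶜ, 2 ∉ f.vars := fun f hf h2 =>
    mem_supported.mp hf (Finset.mem_coe.mpr h2) rfl
  have hne : (X 4 - X 0 : MvPolynomial (Fin 6) K) ≠ 0 :=
    sub_ne_zero.mpr fun h => by simpa using X_injective h
  rw [h, ← irreducible_iff_prime]
  refine irreducible_mul_X_add _ _ 2 hne (hvars _ (sub_mem (hX 4 (by decide)) (hX 0 (by decide))))
    (hvars _ (sub_mem (sub_mem (add_mem (mul_mem (hX 0 (by decide)) (hX 3 (by decide)))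
      (mul_mem (hX 0 (by decide)) (hX 1 (by decide))))
      (mul_mem (hX 1 (by decide)) (hX 3 (by decide))))
      (mul_mem (hX 0 (by decide)) (hX 4 (by decide))))) ?_
  -- The point is a zero of `X 4 - X 0` at which the part free of `X 2` equals `-1`.
  refine isRelPrime_of_irreducible_of_eval
    (irreducible_of_isHomogeneous_one ((isHomogeneous_X K _).sub (isHomogeneous_X K _)) hne)
    ![1, 0, 0, 0, 1, 0] ?_ ?_ <;> simp

theorem not_dvd_signedMinors_braid :
    ¬ signedMinors (braidRow₁ K) (braidRow₂ K) 0 ∣ signedMinors (braidRow₁ K) (braidRow₂ K) 1 := by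
  rintro ⟨c, hc⟩
  have := congrArg (eval (![0, 0, 1, 0, 0, 1] : Fin 6 → K)) hc
  simp [signedMinors, braidRow₁, braidRow₂] at this

theorem braidQuadric_notMem :
    braidQuadric K ∉ Ideal.span (Set.range (signedMinors (braidRow₁ K) (braidRow₂ K))) := by
  intro h
  -- At this point the first row of the matrix vanishes, hence so do all minors, while the quadric
  -- equals 1.
  have hle : Ideal.span (Set.range (signedMinors (braidRow₁ K) (braidRow₂ K))) ≤
      RingHom.ker (eval (![1, 1, 0, 0, 1, 1] : Fin 6 → K)) := by
    rw [Ideal.span_le]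
    rintro _ ⟨i, rfl⟩
    fin_cases i <;> simp [signedMinors, braidRow₁, braidRow₂]
  have := hle h
  simp [braidQuadric] at this

/-! ### Primality of the ideal of minors -/

section Parametrization

variable {K} {L : Type*} [Field L] [Algebra K L]

/-- A parametrization of the variety of the maximal minors. -/
noncomputable def braidMinorsMap (x : Fin 4 → L) : MvPolynomial (Fin 6) K →ₐ[K] L :=
  aeval ![(x 0)⁻¹, (x 1)⁻¹, ((x 0)⁻¹ + (x 1)⁻¹) / 2 + ((x 0)⁻¹ - (x 1)⁻¹) / 2 * (x 3)⁻¹, (x 2)⁻¹,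
    2 * (x 2)⁻¹ - (x 0)⁻¹ + 2 * ((x 2)⁻¹ - (x 0)⁻¹) * (x 3 - 1)⁻¹,
    - (x 1)⁻¹ - 2 * (x 2)⁻¹ + 2 * ((x 1)⁻¹ + (x 2)⁻¹) * (x 3 + 1)⁻¹]

/-- With `t = x 3`, the parametrization solves "second row = `λ` times first row" for `y₂, y₄, y₅`,
where `λ = (t - 1) / (2 t)`. The poles in `λ` would be `∞, 0, 1`; the change of coordinate moves
them to the finite points `0, 1, -1`, which are distinct since `2 ≠ 0`. -/
theorem ker_braidMinorsMap (hK : (2 : K) ≠ 0) {x : Fin 4 → L} (hx : AlgebraicIndependent K x) :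
    RingHom.ker (braidMinorsMap (K := K) x) =
      Ideal.span (Set.range (signedMinors (braidRow₁ K) (braidRow₂ K))) := by
  set J := Ideal.span (Set.range (signedMinors (braidRow₁ K) (braidRow₂ K))) with hJ
  have hxne : ∀ i, x i ≠ 0 := hx.ne_zero
  have h2 : (2 : L) ≠ 0 := by
    rw [← map_ofNat (algebraMap K L) 2]
    exact (map_ne_zero _).mpr hK
  have h3m : x 3 - 1 ≠ 0 := by
    have := hx.aeval_ne_zero_of_eval (p := X 3 - 1) 0 (by simp)
    rwa [map_sub, aeval_X, map_one] at this
  have h3p : x 3 + 1 ≠ 0 := by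
    have := hx.aeval_ne_zero_of_eval (p := X 3 + 1) 0 (by simp)
    rwa [map_add, aeval_X, map_one] at this
  have h12 : x 2 + x 1 ≠ 0 := by
    have := hx.aeval_ne_zero_of_eval (p := X 2 + X 1) ![0, 1, 0, 0] (by simp)
    rwa [map_add, aeval_X, aeval_X] at this
  have hker : ∀ p ∈ J, braidMinorsMap x p = 0 := by
    suffices J ≤ RingHom.ker (braidMinorsMap x) from fun p hp => this hp
    rw [hJ, Ideal.span_le]
    rintro _ ⟨i, rfl⟩
    change braidMinorsMap x _ = 0
    have e0 := hxne 0
    have e1 := hxne 1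
    have e2 := hxne 2
    have e3 := hxne 3
    fin_cases i <;>
      simp only [signedMinors, braidRow₁, braidRow₂, braidMinorsMap, Matrix.cons_val, map_sub,
        map_mul, map_add, aeval_X, Fin.zero_eta, Fin.mk_one, Fin.reduceFinMk] <;>
      field_simp <;> ring
  set ψ := Ideal.Quotient.liftₐ J (braidMinorsMap x) hker with hψ
  set Y : Fin 6 → MvPolynomial (Fin 6) K ⧸ J := fun i => Ideal.Quotient.mk J (X i) with hY
  have hψY : ∀ i, ψ (Y i) = braidMinorsMap x (X i) := fun i => rfl
  set c : MvPolynomial (Fin 6) K ⧸ J := algebraMap K _ 2⁻¹ with hc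
  have hc2 : 2 * c = 1 := by
    rw [hc, ← map_ofNat (algebraMap K _) 2, ← map_mul, mul_inv_cancel₀ hK, map_one]
  have hψc : ψ c = 2⁻¹ := by
    rw [hc, AlgHom.commutes, map_inv₀, map_ofNat]
  have hψ2 : ψ 2 = 2 := map_ofNat ψ 2
  have hrel : ∀ i, Ideal.Quotient.mk J (signedMinors (braidRow₁ K) (braidRow₂ K) i) = 0 := fun i =>
    Ideal.Quotient.eq_zero_iff_mem.mpr (Ideal.subset_span ⟨i, rfl⟩)
  have r0 := hrel 0
  have r1 := hrel 1
  have r2 := hrel 2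
  simp only [signedMinors, braidRow₁, braidRow₂, Matrix.cons_val, map_sub, map_mul, map_add]
    at r0 r1 r2
  change (Y 0 - Y 4) * (Y 0 - Y 2) - (Y 0 - Y 1) * (Y 0 - Y 3) = 0 at r0
  change (Y 0 - Y 1) * (Y 5 + Y 3) - (Y 5 - Y 1) * (Y 0 - Y 2) = 0 at r1
  change (Y 5 - Y 1) * (Y 0 - Y 3) - (Y 0 - Y 4) * (Y 5 + Y 3) = 0 at r2
  have E0 := embedsInto_bot (ψ := ψ) x
  have E1 := E0.adjoin_simple_pole hx (k := 0) (by simp) (Y 0) (by simp [hψY, braidMinorsMap])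
  have E2 := E1.adjoin_simple_pole hx (k := 1) (by simp) (Y 1) (by simp [hψY, braidMinorsMap])
  have E3 := E2.adjoin_simple_pole hx (k := 2) (by simp) (Y 3) (by simp [hψY, braidMinorsMap])
  set A := Algebra.adjoin K (_ ∪ Set.range ![Y 3]) with hA
  have hY0 : Y 0 ∈ A :=
    mem_adjoin_union_left (mem_adjoin_union_left (mem_adjoin_union_range ![Y 0] 0))
  have hY1 : Y 1 ∈ A := mem_adjoin_union_left (mem_adjoin_union_range ![Y 1] 0)
  have hY3 : Y 3 ∈ A := mem_adjoin_union_range ![Y 3] 0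
  have hcA : c ∈ A := A.algebraMap_mem _
  have h2A : (2 : MvPolynomial (Fin 6) K ⧸ J) ∈ A := ofNat_mem A 2
  set F := IntermediateField.adjoin K (x '' insert 2 (insert 1 (insert 0 ∅))) with hF
  have hxF : ∀ i, i ≠ 3 → (x i)⁻¹ ∈ F := fun i hi =>
    inv_mem (IntermediateField.subset_adjoin _ _ ⟨i, by fin_cases i <;> simp at hi ⊢, rfl⟩)
  have h2F : (2 : L) ∈ F := ofNat_mem F 2
  -- Each new generator is `y₂`, `y₄` or `y₅` minus its value at `t = ∞`, so that only the polar
  -- part remains.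
  have E4 := E3.adjoin_simple_poles hx (k := 3) (by simp)
    ![Y 2 - c * (Y 0 + Y 1), Y 4 + Y 0 - 2 * Y 3, Y 5 + 2 * Y 3 + Y 1]
    ![0, 1, -1] ![((x 0)⁻¹ - (x 1)⁻¹) / 2, 2 * ((x 2)⁻¹ - (x 0)⁻¹), 2 * ((x 1)⁻¹ + (x 2)⁻¹)]
    ?_ ?_ ?_ ?_ ?_ ?_
  · refine ker_eq_of_embedsInto hker E4 fun i => ?_
    set u := ![Y 2 - c * (Y 0 + Y 1), Y 4 + Y 0 - 2 * Y 3, Y 5 + 2 * Y 3 + Y 1] with hu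
    set B := Algebra.adjoin K (A ∪ Set.range u)
    have hAB : ∀ y ∈ A, y ∈ B := fun y hy => mem_adjoin_union_left hy
    have hB2 : Y 2 ∈ B := by
      have h : Y 2 = u 0 + c * (Y 0 + Y 1) := by simp [hu]
      rw [h]
      exact add_mem (mem_adjoin_union_range u 0) (hAB _ (mul_mem hcA (add_mem hY0 hY1)))
    have hB4 : Y 4 ∈ B := by
      have h : Y 4 = u 1 + (2 * Y 3 - Y 0) := by simp [hu]
      rw [h]
      exact add_mem (mem_adjoin_union_range u 1) (hAB _ (sub_mem (mul_mem h2A hY3) hY0))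
    have hB5 : Y 5 ∈ B := by
      have h : Y 5 = u 2 - (2 * Y 3 + Y 1) := by
        simp only [hu, Matrix.cons_val]
        ring
      rw [h]
      exact sub_mem (mem_adjoin_union_range u 2) (hAB _ (add_mem (mul_mem h2A hY3) hY1))
    change Y i ∈ B
    fin_cases i
    exacts [hAB _ hY0, hAB _ hY1, hB2, hAB _ hY3, hB4, hB5]
  · intro i j hij
    have h11 : (1 : L) ≠ -1 := fun h => h2 (by linear_combination h)
    fin_cases i <;> fin_cases j <;> first | exact absurd hij (by decide) | skip
    · simp
    · simp
    · simpa using h11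
  · intro i
    fin_cases i
    exacts [zero_mem F, one_mem F, neg_mem (one_mem F)]
  · intro i
    have m0 := hxF 0 (by decide)
    have m1 := hxF 1 (by decide)
    have m2 := hxF 2 (by decide)
    fin_cases i
    exacts [div_mem (sub_mem m0 m1) h2F, mul_mem h2F (sub_mem m2 m0), mul_mem h2F (add_mem m1 m2)]
  · intro i
    fin_cases i
    · exact div_ne_zero (sub_ne_zero.mpr (inv_injective.ne (hx.injective.ne (by decide)))) h2
    · exact mul_ne_zero h2 (sub_ne_zero.mpr (inv_injective.ne (hx.injective.ne (by decide))))
    · refine mul_ne_zero h2 ?_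
      rw [inv_add_inv (hxne 1) (hxne 2), add_comm]
      exact div_ne_zero h12 (mul_ne_zero (hxne 1) (hxne 2))
  · intro i
    fin_cases i <;>
      simp [hψY, hψc, hψ2, braidMinorsMap] <;> ring
  · intro i j hij
    fin_cases i <;> fin_cases j <;> first | exact absurd hij (by decide) | skip
    · refine ⟨-(2 * (Y 3 - Y 0)), neg_mem (mul_mem h2A (sub_mem hY3 hY0)),
        c * (Y 0 - Y 1), mul_mem hcA (sub_mem hY0 hY1), ?_⟩
      simp only [Matrix.cons_val, Fin.zero_eta, Fin.mk_one]
      linear_combination r0 + (-(Y 4 + Y 0 - 2 * Y 3) * Y 0 - (Y 3 - Y 0) * (Y 0 + Y 1)) * hc2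
    · refine ⟨2 * (Y 1 + Y 3), mul_mem h2A (add_mem hY1 hY3),
        -(c * (Y 0 - Y 1)), neg_mem (mul_mem hcA (sub_mem hY0 hY1)), ?_⟩
      simp only [Matrix.cons_val, Fin.zero_eta, Fin.reduceFinMk]
      linear_combination r1 + (-(Y 5 + 2 * Y 3 + Y 1) * Y 1 + (Y 1 + Y 3) * (Y 0 + Y 1)) * hc2
    · refine ⟨c * (2 * (Y 1 + Y 3)), mul_mem hcA (mul_mem h2A (add_mem hY1 hY3)),
        -(c * (2 * (Y 3 - Y 0))), neg_mem (mul_mem hcA (mul_mem h2A (sub_mem hY3 hY0))), ?_⟩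
      simp only [Matrix.cons_val, Fin.mk_one, Fin.reduceFinMk]
      linear_combination r2 - ((Y 1 + Y 3) * (Y 4 + Y 0 - 2 * Y 3) -
        (Y 3 - Y 0) * (Y 5 + 2 * Y 3 + Y 1)) * hc2

end Parametrization

theorem isPrime_span_signedMinors_braid (hK : (2 : K) ≠ 0) :
    (Ideal.span (Set.range (signedMinors (braidRow₁ K) (braidRow₂ K)))).IsPrime := by
  rw [← ker_braidMinorsMap hK (algebraicIndependent_fractionRing_X K 4)]
  exact RingHom.ker_isPrime _

/-- Each minor is, up to adding or subtracting the quadric, the relation of another circuit of three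
forms. The tower introduces `x`, `y`, `z` in this order, and the four circuit relations are exactly
the product rules it needs. -/
theorem orlikTeraoIdeal_braidForms :
    orlikTeraoIdeal (braidForms K) = Ideal.span {braidQuadric K} ⊔
      Ideal.span (Set.range (signedMinors (braidRow₁ K) (braidRow₂ K))) := by
  set I := Ideal.span {braidQuadric K} ⊔
    Ideal.span (Set.range (signedMinors (braidRow₁ K) (braidRow₂ K))) with hI
  have hx := algebraicIndependent_fractionRing_X K 3
  set x : Fin 3 → FractionRing (MvPolynomial (Fin 3) K) := fun i =>
    algebraMap (MvPolynomial (Fin 3) K) _ (X i) with hxdef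
  have e0 : x 0 ≠ 0 := hx.ne_zero 0
  have e1 : x 1 ≠ 0 := hx.ne_zero 1
  have e2 : x 2 ≠ 0 := hx.ne_zero 2
  have e01 : x 0 - x 1 ≠ 0 := sub_ne_zero.mpr (hx.injective.ne (by decide))
  have e02 : x 0 - x 2 ≠ 0 := sub_ne_zero.mpr (hx.injective.ne (by decide))
  have e12 : x 1 - x 2 ≠ 0 := sub_ne_zero.mpr (hx.injective.ne (by decide))
  have hφ : orlikTeraoMap (braidForms K) =
      aeval ![(x 0)⁻¹, (x 1)⁻¹, (x 2)⁻¹, (x 0 - x 1)⁻¹, (x 0 - x 2)⁻¹, (x 1 - x 2)⁻¹] := by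
    rw [orlikTeraoMap]
    congr 1
    funext i
    fin_cases i <;> simp [braidForms, hxdef]
  have hker : ∀ p ∈ I, orlikTeraoMap (braidForms K) p = 0 := by
    suffices I ≤ RingHom.ker (orlikTeraoMap (braidForms K)) from fun p hp => this hp
    rw [hI, sup_le_iff, Ideal.span_le, Ideal.span_le, Set.singleton_subset_iff]
    constructor
    · change orlikTeraoMap _ _ = 0
      simp only [hφ, braidQuadric, Matrix.cons_val, map_sub, map_mul, aeval_X]
      field_simp
      ring
    · rintro _ ⟨i, rfl⟩
      change orlikTeraoMap _ _ = 0
      fin_cases i <;>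
        simp only [hφ, signedMinors, braidRow₁, braidRow₂, Matrix.cons_val, map_sub, map_mul,
          map_add, aeval_X, Fin.zero_eta, Fin.mk_one, Fin.reduceFinMk] <;>
        field_simp <;> ring
  set ψ := Ideal.Quotient.liftₐ I (orlikTeraoMap (braidForms K)) hker with hψ
  set Y : Fin 6 → MvPolynomial (Fin 6) K ⧸ I := fun i => Ideal.Quotient.mk I (X i) with hY
  have hψY : ∀ i, ψ (Y i) = orlikTeraoMap (braidForms K) (X i) := fun i => rfl
  have rq : Ideal.Quotient.mk I (braidQuadric K) = 0 := Ideal.Quotient.eq_zero_iff_mem.mpr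
    (Ideal.mem_sup_left (Ideal.mem_span_singleton_self _))
  have hrel : ∀ i, Ideal.Quotient.mk I (signedMinors (braidRow₁ K) (braidRow₂ K) i) = 0 := fun i =>
    Ideal.Quotient.eq_zero_iff_mem.mpr (Ideal.mem_sup_right (Ideal.subset_span ⟨i, rfl⟩))
  have r0 := hrel 0
  have r1 := hrel 1
  have r2 := hrel 2
  simp only [signedMinors, braidRow₁, braidRow₂, braidQuadric, Matrix.cons_val, map_sub, map_mul,
    map_add] at rq r0 r1 r2
  change Y 0 * Y 1 - Y 3 * (Y 1 - Y 0) = 0 at rq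
  change (Y 0 - Y 4) * (Y 0 - Y 2) - (Y 0 - Y 1) * (Y 0 - Y 3) = 0 at r0
  change (Y 0 - Y 1) * (Y 5 + Y 3) - (Y 5 - Y 1) * (Y 0 - Y 2) = 0 at r1
  change (Y 5 - Y 1) * (Y 0 - Y 3) - (Y 0 - Y 4) * (Y 5 + Y 3) = 0 at r2
  have E0 := embedsInto_bot (ψ := ψ) x
  have E1 := E0.adjoin_simple_pole hx (k := 0) (by simp) (Y 0) (by simp [hψY, hφ])
  set A := Algebra.adjoin K (_ ∪ Set.range ![Y 0]) with hA
  set F := IntermediateField.adjoin K (x '' insert 0 ∅) with hF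
  have hY0 : Y 0 ∈ A := mem_adjoin_union_range ![Y 0] 0
  have hx0 : x 0 ∈ F := IntermediateField.subset_adjoin _ _ ⟨0, by simp, rfl⟩
  -- As a function of the new variable `y`, `1 / (x - y)` is `-(y - x)⁻¹`; hence the residue `-1` at
  -- `x`.
  have E2 := E1.adjoin_simple_poles hx (k := 1) (by simp) ![Y 1, Y 3] ![0, x 0] ![1, -1]
    (by
      intro i j hij
      fin_cases i <;> fin_cases j <;> first | exact absurd hij (by decide) | skip
      exact e0.symm)
    (by
      intro i
      fin_cases i
      exacts [zero_mem F, hx0])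
    (by
      intro i
      fin_cases i
      exacts [one_mem F, neg_mem (one_mem F)])
    (by
      intro i
      fin_cases i <;> simp)
    (by
      intro i
      fin_cases i <;> simp [hψY, hφ, ← inv_neg])
    (by
      intro i j hij
      fin_cases i <;> fin_cases j <;> first | exact absurd hij (by decide) | skip
      refine ⟨Y 0, hY0, Y 0, hY0, ?_⟩
      change Y 1 * Y 3 = Y 0 * Y 1 + Y 0 * Y 3
      linear_combination -rq)
  set A' := Algebra.adjoin K (A ∪ Set.range ![Y 1, Y 3]) with hA'
  set F' := IntermediateField.adjoin K (x '' insert 1 (insert 0 ∅)) with hF'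
  have hY0' : Y 0 ∈ A' := mem_adjoin_union_left hY0
  have hY1' : Y 1 ∈ A' := mem_adjoin_union_range ![Y 1, Y 3] 0
  have hY3' : Y 3 ∈ A' := mem_adjoin_union_range ![Y 1, Y 3] 1
  have E3 := E2.adjoin_simple_poles hx (k := 2) (by simp) ![Y 2, Y 4, Y 5] ![0, x 0, x 1] ![1, -1, -1]
    (by
      intro i j hij
      fin_cases i <;> fin_cases j <;> first | exact absurd hij (by decide) | skip
      exacts [e0.symm, e1.symm, sub_ne_zero.mp e01])
    (by
      intro i
      fin_cases i
      exacts [zero_mem F', IntermediateField.subset_adjoin _ _ ⟨0, by simp, rfl⟩,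
        IntermediateField.subset_adjoin _ _ ⟨1, by simp, rfl⟩])
    (by
      intro i
      fin_cases i
      exacts [one_mem F', neg_mem (one_mem F'), neg_mem (one_mem F')])
    (by
      intro i
      fin_cases i <;> simp)
    (by
      intro i
      fin_cases i <;> simp [hψY, hφ, ← inv_neg])
    (by
      intro i j hij
      fin_cases i <;> fin_cases j <;> first | exact absurd hij (by decide) | skip
      · refine ⟨Y 0, hY0', Y 0, hY0', ?_⟩
        change Y 2 * Y 4 = Y 0 * Y 2 + Y 0 * Y 4
        linear_combination r0 - rq
      · refine ⟨Y 1, hY1', Y 1, hY1', ?_⟩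
        change Y 2 * Y 5 = Y 1 * Y 2 + Y 1 * Y 5
        linear_combination r1 - rq
      · refine ⟨-Y 3, neg_mem hY3', Y 3, hY3', ?_⟩
        change Y 4 * Y 5 = -Y 3 * Y 4 + Y 3 * Y 5
        linear_combination r2 + rq)
  refine ker_eq_of_embedsInto hker E3 fun i => ?_
  set B := Algebra.adjoin K (A' ∪ Set.range ![Y 2, Y 4, Y 5])
  have hB : ∀ y ∈ A', y ∈ B := fun y hy => mem_adjoin_union_left hy
  have hu := mem_adjoin_union_range (A := A') ![Y 2, Y 4, Y 5]
  change Y i ∈ B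
  fin_cases i
  exacts [hB _ hY0', hB _ hY1', hu 0, hB _ hY3', hu 1, hu 2]

theorem isOrlikTeraoBetti_braidForms (hK : (2 : K) ≠ 0) :
    IsOrlikTeraoBetti (braidForms K) commonBettiTable := by
  have hX := isHomogeneous_X (σ := Fin 6) K
  refine isOrlikTeraoBetti_of_ideal_eq (orlikTeraoIdeal_braidForms K)
    (nonempty_resolution_of_quadric_of_signedMinors ?_ ?_ ?_ (prime_signedMinors_braid K)
      (not_dvd_signedMinors_braid K) (isPrime_span_signedMinors_braid K hK)
      (braidQuadric_notMem K))
  · intro i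
    fin_cases i
    exacts [(hX _).sub (hX _), (hX _).sub (hX _), (hX _).sub (hX _)]
  · intro i
    fin_cases i
    exacts [(hX _).add (hX _), (hX _).sub (hX _), (hX _).sub (hX _)]
  · exact ((hX _).mul (hX _)).sub ((hX _).mul ((hX _).sub (hX _)))

end Braid

/-! ### The arrangement `x, y, x + y, x - y, z, y - z` -/

section Pencil

open MvPolynomial

variable (K : Type*) [Field K]

/-- The first row of the `2 × 3` matrix for the pencil `x, y, x + y, x - y`. -/
noncomputable def pencilRow₁ : Fin 3 → MvPolynomial (Fin 6) K :=
  ![2 * X 1 + X 3 - X 2, X 2 + X 3, X 3 - X 2]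

/-- The second row of the `2 × 3` matrix for the pencil `x, y, x + y, x - y`. -/
noncomputable def pencilRow₂ : Fin 3 → MvPolynomial (Fin 6) K :=
  ![X 2 + X 3, X 3 - X 2, X 2 + X 3 - 2 * X 0]

/-- The quadric relation of `y, z, y - z`. -/
noncomputable def pencilQuadric : MvPolynomial (Fin 6) K :=
  X 4 * X 5 - X 1 * (X 4 + X 5)

/-- The linear forms `x, y, x + y, x - y, z, y - z`. -/
noncomputable def pencilForms : Fin 6 → MvPolynomial (Fin 3) K :=
  ![X 0, X 1, X 0 + X 1, X 0 - X 1, X 2, X 1 - X 2]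

/-- Again the minor has degree one in a single variable, here `X 0`, with coprime coefficients. -/
theorem prime_signedMinors_pencil (hK : (2 : K) ≠ 0) :
    Prime (signedMinors (pencilRow₁ K) (pencilRow₂ K) 0) := by
  have h : signedMinors (pencilRow₁ K) (pencilRow₂ K) 0 =
      (-(X 2 + X 3 + (X 2 + X 3))) * X 0 + 2 * X 2 * (2 * X 3) := by
    simp only [signedMinors, pencilRow₁, pencilRow₂, Matrix.cons_val]
    ring
  have hX : ∀ j : Fin 6, j ≠ 0 → (X j : MvPolynomial (Fin 6) K) ∈ supported K {0}ᶜ :=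
    fun j hj => X_mem_supported.mpr hj
  have h2 : (2 : MvPolynomial (Fin 6) K) ∈ supported K {0}ᶜ := ofNat_mem _ 2
  have hvars : ∀ f ∈ supported K {(0 : Fin 6)}ᶜ, 0 ∉ f.vars := fun f hf h0 =>
    mem_supported.mp hf (Finset.mem_coe.mpr h0) rfl
  have hne : (-(X 2 + X 3 + (X 2 + X 3)) : MvPolynomial (Fin 6) K) ≠ 0 := by
    intro h
    have := congrArg (eval (![0, 0, 1, 0, 0, 0] : Fin 6 → K)) h
    simp only [map_neg, map_add, eval_X, Matrix.cons_val, map_zero] at this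
    exact hK (by linear_combination -this)
  have h23 := add_mem (hX 2 (by decide)) (hX 3 (by decide))
  have hhom := (isHomogeneous_X K (2 : Fin 6)).add (isHomogeneous_X K 3)
  rw [h, ← irreducible_iff_prime]
  refine irreducible_mul_X_add _ _ 0 hne (hvars _ (neg_mem (add_mem h23 h23)))
    (hvars _ (mul_mem (mul_mem h2 (hX 2 (by decide))) (mul_mem h2 (hX 3 (by decide))))) ?_
  refine isRelPrime_of_irreducible_of_eval
    (irreducible_of_isHomogeneous_one (hhom.add hhom).neg hne)
    ![0, 0, 1, -1, 0, 0] ?_ ?_ <;> simp [hK]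

theorem not_dvd_signedMinors_pencil (hK : (2 : K) ≠ 0) :
    ¬ signedMinors (pencilRow₁ K) (pencilRow₂ K) 0 ∣
      signedMinors (pencilRow₁ K) (pencilRow₂ K) 1 := by
  rintro ⟨c, hc⟩
  have := congrArg (eval (![0, 1, 1, 0, 0, 0] : Fin 6 → K)) hc
  simp only [signedMinors, pencilRow₁, pencilRow₂, Matrix.cons_val, map_mul, map_sub, map_add,
    eval_X, map_ofNat] at this
  exact hK (by linear_combination -this)

theorem pencilQuadric_notMem :
    pencilQuadric K ∉ Ideal.span (Set.range (signedMinors (pencilRow₁ K) (pencilRow₂ K))) := by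
  intro h
  -- The minors involve only `y₀, …, y₃`, all zero at this point.
  have hle : Ideal.span (Set.range (signedMinors (pencilRow₁ K) (pencilRow₂ K))) ≤
      RingHom.ker (eval (![0, 0, 0, 0, 1, 1] : Fin 6 → K)) := by
    rw [Ideal.span_le]
    rintro _ ⟨i, rfl⟩
    fin_cases i <;> simp [signedMinors, pencilRow₁, pencilRow₂]
  have := hle h
  simp [pencilQuadric] at this

variable {K}

/-- The part of the tower generated by `y₀, …, y₃`, needed both for `J` and for the full ideal.
After `1 / y`, the functions `1 / x`, `1 / (x + y)`, `1 / (x - y)` have simple poles in `x` at `0,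
-y, y`. -/
theorem exists_embedsInto_pencil (hK : (2 : K) ≠ 0) {R L : Type*} [CommRing R] [Algebra K R]
    [Field L] [Algebra K L] {ψ : R →ₐ[K] L} {κ : Type*} {x : κ → L}
    (hx : AlgebraicIndependent K x) {k₀ k₁ : κ} (hk : k₀ ≠ k₁) {Y : Fin 6 → R}
    (r0 : (Y 2 + Y 3) * (Y 2 + Y 3 - 2 * Y 0) - (Y 3 - Y 2) * (Y 3 - Y 2) = 0)
    (r1 : (Y 3 - Y 2) * (Y 2 + Y 3) - (2 * Y 1 + Y 3 - Y 2) * (Y 2 + Y 3 - 2 * Y 0) = 0)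
    (r2 : (2 * Y 1 + Y 3 - Y 2) * (Y 3 - Y 2) - (Y 2 + Y 3) * (Y 2 + Y 3) = 0)
    (h0 : ψ (Y 0) = (x k₀)⁻¹) (h1 : ψ (Y 1) = (x k₁)⁻¹) (h2 : ψ (Y 2) = (x k₀ + x k₁)⁻¹)
    (h3 : ψ (Y 3) = (x k₀ - x k₁)⁻¹) :
    ∃ A : Subalgebra K R, EmbedsInto ψ A (IntermediateField.adjoin K (x '' {k₀, k₁})) ∧
      Y 0 ∈ A ∧ Y 1 ∈ A ∧ Y 2 ∈ A ∧ Y 3 ∈ A := by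
  set c : R := algebraMap K _ 2⁻¹ with hc
  have hc2 : 2 * c = 1 := by
    rw [hc, ← map_ofNat (algebraMap K _) 2, ← map_mul, mul_inv_cancel₀ hK, map_one]
  have hL2 : (2 : L) ≠ 0 := by
    rw [← map_ofNat (algebraMap K L) 2]
    exact (map_ne_zero _).mpr hK
  -- The minors are twice the useful relations, so `c = 1 / 2` is used throughout. `hsum` and
  -- `hdiff` are a sum and a difference of the circuit relations of `x, y, x + y` and of `x, y, x -
  -- y`; `h03` isolates the latter.
  have h23 : 2 * Y 2 * Y 3 - Y 1 * Y 3 + Y 1 * Y 2 = 0 := by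
    linear_combination -c * r2 - (2 * Y 2 * Y 3 - Y 1 * Y 3 + Y 1 * Y 2) * hc2
  have hsum : Y 0 * Y 2 + Y 1 * Y 2 + Y 0 * Y 3 - Y 1 * Y 3 = 0 := by
    linear_combination h23 - c * r0 - (Y 0 * Y 2 + Y 0 * Y 3 - 2 * Y 2 * Y 3) * hc2
  have hdiff : Y 0 * Y 3 - Y 1 * Y 3 + 2 * Y 0 * Y 1 - Y 0 * Y 2 - Y 1 * Y 2 = 0 := by
    linear_combination c * r1 -
      (Y 0 * Y 3 - Y 1 * Y 3 + 2 * Y 0 * Y 1 - Y 0 * Y 2 - Y 1 * Y 2) * hc2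
  have h03 : Y 0 * Y 3 - Y 1 * Y 3 + Y 0 * Y 1 = 0 := by
    linear_combination c * hsum + c * hdiff - (Y 0 * Y 3 - Y 1 * Y 3 + Y 0 * Y 1) * hc2
  have E0 := embedsInto_bot (ψ := ψ) x
  have E1 := E0.adjoin_simple_pole hx (k := k₁) (by simp) (Y 1) h1
  set A := Algebra.adjoin K (_ ∪ Set.range ![Y 1]) with hA
  set F := IntermediateField.adjoin K (x '' insert k₁ ∅) with hF
  have hY1 : Y 1 ∈ A := mem_adjoin_union_range ![Y 1] 0
  have hcA : c ∈ A := A.algebraMap_mem _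
  have hx1 : x k₁ ∈ F := IntermediateField.subset_adjoin _ _ ⟨k₁, by simp, rfl⟩
  have hne := hx.ne_zero k₁
  have E2 := E1.adjoin_simple_poles hx (k := k₀) (by simpa using hk) ![Y 0, Y 2, Y 3]
    ![0, -x k₁, x k₁] 1
    (by
      intro i j hij
      fin_cases i <;> fin_cases j <;> first | exact absurd hij (by decide) | skip
      · exact (neg_ne_zero.mpr hne).symm
      · exact hne.symm
      · exact fun h : -x k₁ = x k₁ => mul_ne_zero hL2 hne (by linear_combination -h))
    (by
      intro i
      fin_cases i
      exacts [zero_mem F, neg_mem hx1, hx1])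
    (fun _ => one_mem F) (fun _ => one_ne_zero)
    (by
      intro i
      fin_cases i <;> simp [h0, h2, h3])
    (by
      intro i j hij
      fin_cases i <;> fin_cases j <;> first | exact absurd hij (by decide) | skip
      · refine ⟨Y 1, hY1, -Y 1, neg_mem hY1, ?_⟩
        change Y 0 * Y 2 = Y 1 * Y 0 + -Y 1 * Y 2
        linear_combination hsum - h03
      · refine ⟨-Y 1, neg_mem hY1, Y 1, hY1, ?_⟩
        change Y 0 * Y 3 = -Y 1 * Y 0 + Y 1 * Y 3
        linear_combination h03
      · refine ⟨-(c * Y 1), neg_mem (mul_mem hcA hY1), c * Y 1, mul_mem hcA hY1, ?_⟩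
        change Y 2 * Y 3 = -(c * Y 1) * Y 2 + c * Y 1 * Y 3
        linear_combination c * h23 - Y 2 * Y 3 * hc2)
  have hu := mem_adjoin_union_range (A := A) ![Y 0, Y 2, Y 3]
  refine ⟨_, ?_, hu 0, mem_adjoin_union_left hY1, hu 1, hu 2⟩
  simpa only [insert_empty_eq] using E2

/-- A parametrization of the variety of the maximal minors. -/
noncomputable def pencilMinorsMap {L : Type*} [Field L] [Algebra K L] (x : Fin 4 → L) :
    MvPolynomial (Fin 6) K →ₐ[K] L :=
  aeval ![(x 0)⁻¹, (x 1)⁻¹, (x 0 + x 1)⁻¹, (x 0 - x 1)⁻¹, (x 2)⁻¹, (x 3)⁻¹]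

theorem AlgebraicIndependent.add_ne_zero {L : Type*} [Field L] [Algebra K L] {κ : Type*}
    [DecidableEq κ] {x : κ → L} (hx : AlgebraicIndependent K x) {i j : κ} (hij : i ≠ j) :
    x i + x j ≠ 0 := by
  have := hx.aeval_ne_zero_of_eval (p := X i + X j) (Pi.single i 1) (by simp [hij.symm])
  rwa [map_add, aeval_X, aeval_X] at this

/-- Up to the common factor `2 / (x y (x² - y²))`, the rows of the matrix become `x³, x² y, x y²`
and `x² y, x y², y³`: the four concurrent lines give a twisted cubic. The remaining coordinates `y₄,
y₅` are free, whence two further independent parameters. -/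
theorem ker_pencilMinorsMap (hK : (2 : K) ≠ 0) {L : Type*} [Field L] [Algebra K L] {x : Fin 4 → L}
    (hx : AlgebraicIndependent K x) : RingHom.ker (pencilMinorsMap (K := K) x) =
      Ideal.span (Set.range (signedMinors (pencilRow₁ K) (pencilRow₂ K))) := by
  set J := Ideal.span (Set.range (signedMinors (pencilRow₁ K) (pencilRow₂ K))) with hJ
  have e0 := hx.ne_zero 0
  have e1 := hx.ne_zero 1
  have e01 : x 0 - x 1 ≠ 0 := sub_ne_zero.mpr (hx.injective.ne (by decide))
  have e01' : x 0 + x 1 ≠ 0 := hx.add_ne_zero (by decide)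
  have hker : ∀ p ∈ J, pencilMinorsMap x p = 0 := by
    suffices J ≤ RingHom.ker (pencilMinorsMap x) from fun p hp => this hp
    rw [hJ, Ideal.span_le]
    rintro _ ⟨i, rfl⟩
    change pencilMinorsMap x _ = 0
    fin_cases i <;>
      simp only [signedMinors, pencilRow₁, pencilRow₂, pencilMinorsMap, Matrix.cons_val, map_sub,
        map_mul, map_add, map_ofNat, aeval_X, Fin.zero_eta, Fin.mk_one, Fin.reduceFinMk] <;>
      field_simp <;> ring
  set ψ := Ideal.Quotient.liftₐ J (pencilMinorsMap x) hker with hψ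
  set Y : Fin 6 → MvPolynomial (Fin 6) K ⧸ J := fun i => Ideal.Quotient.mk J (X i) with hY
  have hψY : ∀ i, ψ (Y i) = pencilMinorsMap x (X i) := fun i => rfl
  have hrel : ∀ i, Ideal.Quotient.mk J (signedMinors (pencilRow₁ K) (pencilRow₂ K) i) = 0 :=
    fun i => Ideal.Quotient.eq_zero_iff_mem.mpr (Ideal.subset_span ⟨i, rfl⟩)
  obtain ⟨A, E, h0, h1, h2, h3⟩ := exists_embedsInto_pencil hK hx (ψ := ψ) (k₀ := 0) (k₁ := 1)
    (by decide) (Y := Y) (hrel 0) (hrel 1) (hrel 2) (by simp [hψY, pencilMinorsMap])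
    (by simp [hψY, pencilMinorsMap]) (by simp [hψY, pencilMinorsMap])
    (by simp [hψY, pencilMinorsMap])
  have E1 := E.adjoin_simple_pole hx (k := 2) (by simp) (Y 4) (by simp [hψY, pencilMinorsMap])
  have E2 := E1.adjoin_simple_pole hx (k := 3) (by simp) (Y 5) (by simp [hψY, pencilMinorsMap])
  refine ker_eq_of_embedsInto hker E2 fun i => ?_
  set A' := Algebra.adjoin K (A ∪ Set.range ![Y 4])
  set B := Algebra.adjoin K (A' ∪ Set.range ![Y 5])
  have hB : ∀ y ∈ A, y ∈ B := fun y hy => mem_adjoin_union_left (mem_adjoin_union_left hy)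
  change Y i ∈ B
  fin_cases i
  exacts [hB _ h0, hB _ h1, hB _ h2, hB _ h3,
    mem_adjoin_union_left (mem_adjoin_union_range ![Y 4] 0), mem_adjoin_union_range ![Y 5] 0]

theorem isPrime_span_signedMinors_pencil (hK : (2 : K) ≠ 0) :
    (Ideal.span (Set.range (signedMinors (pencilRow₁ K) (pencilRow₂ K)))).IsPrime := by
  rw [← ker_pencilMinorsMap hK (algebraicIndependent_fractionRing_X K 4)]
  exact RingHom.ker_isPrime _

/-- Above the pencil in `x, y` only the variable `z` is new. The functions `1 / z` and `1 / (y - z)`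
have poles at `0` and `y`, and the quadric is their product rule. -/
theorem orlikTeraoIdeal_pencilForms (hK : (2 : K) ≠ 0) :
    orlikTeraoIdeal (pencilForms K) = Ideal.span {pencilQuadric K} ⊔
      Ideal.span (Set.range (signedMinors (pencilRow₁ K) (pencilRow₂ K))) := by
  set I := Ideal.span {pencilQuadric K} ⊔
    Ideal.span (Set.range (signedMinors (pencilRow₁ K) (pencilRow₂ K))) with hI
  have hx := algebraicIndependent_fractionRing_X K 3
  set x : Fin 3 → FractionRing (MvPolynomial (Fin 3) K) := fun i =>
    algebraMap (MvPolynomial (Fin 3) K) _ (X i) with hxdef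
  have e0 : x 0 ≠ 0 := hx.ne_zero 0
  have e1 : x 1 ≠ 0 := hx.ne_zero 1
  have e2 : x 2 ≠ 0 := hx.ne_zero 2
  have e01 : x 0 - x 1 ≠ 0 := sub_ne_zero.mpr (hx.injective.ne (by decide))
  have e01' : x 0 + x 1 ≠ 0 := hx.add_ne_zero (by decide)
  have e12 : x 1 - x 2 ≠ 0 := sub_ne_zero.mpr (hx.injective.ne (by decide))
  have hφ : orlikTeraoMap (pencilForms K) =
      aeval ![(x 0)⁻¹, (x 1)⁻¹, (x 0 + x 1)⁻¹, (x 0 - x 1)⁻¹, (x 2)⁻¹, (x 1 - x 2)⁻¹] := by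
    rw [orlikTeraoMap]
    congr 1
    funext i
    fin_cases i <;> simp [pencilForms, hxdef]
  have hker : ∀ p ∈ I, orlikTeraoMap (pencilForms K) p = 0 := by
    suffices I ≤ RingHom.ker (orlikTeraoMap (pencilForms K)) from fun p hp => this hp
    rw [hI, sup_le_iff, Ideal.span_le, Ideal.span_le, Set.singleton_subset_iff]
    constructor
    · change orlikTeraoMap _ _ = 0
      simp only [hφ, pencilQuadric, Matrix.cons_val, map_sub, map_mul, map_add, aeval_X]
      field_simp
      ring
    · rintro _ ⟨i, rfl⟩
      change orlikTeraoMap _ _ = 0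
      fin_cases i <;>
        simp only [hφ, signedMinors, pencilRow₁, pencilRow₂, Matrix.cons_val, map_sub, map_mul,
          map_add, map_ofNat, aeval_X, Fin.zero_eta, Fin.mk_one, Fin.reduceFinMk] <;>
        field_simp <;> ring
  set ψ := Ideal.Quotient.liftₐ I (orlikTeraoMap (pencilForms K)) hker with hψ
  set Y : Fin 6 → MvPolynomial (Fin 6) K ⧸ I := fun i => Ideal.Quotient.mk I (X i) with hY
  have hψY : ∀ i, ψ (Y i) = orlikTeraoMap (pencilForms K) (X i) := fun i => rfl
  have rq : Y 4 * Y 5 - Y 1 * (Y 4 + Y 5) = 0 := Ideal.Quotient.eq_zero_iff_mem.mpr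
    (Ideal.mem_sup_left (Ideal.mem_span_singleton_self (pencilQuadric K)))
  have hrel : ∀ i, Ideal.Quotient.mk I (signedMinors (pencilRow₁ K) (pencilRow₂ K) i) = 0 :=
    fun i => Ideal.Quotient.eq_zero_iff_mem.mpr (Ideal.mem_sup_right (Ideal.subset_span ⟨i, rfl⟩))
  obtain ⟨A, E, h0, h1, h2, h3⟩ := exists_embedsInto_pencil hK hx (ψ := ψ) (k₀ := 0) (k₁ := 1)
    (by decide) (Y := Y) (hrel 0) (hrel 1) (hrel 2) (by simp [hψY, hφ])
    (by simp [hψY, hφ]) (by simp [hψY, hφ]) (by simp [hψY, hφ])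
  set F := IntermediateField.adjoin K (x '' {0, 1}) with hF
  have E' := E.adjoin_simple_poles hx (k := 2) (by simp) ![Y 4, Y 5] ![0, x 1] ![1, -1]
    (by
      intro i j hij
      fin_cases i <;> fin_cases j <;> first | exact absurd hij (by decide) | skip
      exact e1.symm)
    (by
      intro i
      fin_cases i
      exacts [zero_mem F, IntermediateField.subset_adjoin _ _ ⟨1, by simp, rfl⟩])
    (by
      intro i
      fin_cases i
      exacts [one_mem F, neg_mem (one_mem F)])
    (by
      intro i
      fin_cases i <;> simp)
    (by
      intro i
      fin_cases i <;> simp [hψY, hφ, ← inv_neg])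
    (by
      intro i j hij
      fin_cases i <;> fin_cases j <;> first | exact absurd hij (by decide) | skip
      refine ⟨Y 1, h1, Y 1, h1, ?_⟩
      change Y 4 * Y 5 = Y 1 * Y 4 + Y 1 * Y 5
      linear_combination rq)
  refine ker_eq_of_embedsInto hker E' fun i => ?_
  set B := Algebra.adjoin K (A ∪ Set.range ![Y 4, Y 5])
  have hB : ∀ y ∈ A, y ∈ B := fun y hy => mem_adjoin_union_left hy
  have hu := mem_adjoin_union_range (A := A) ![Y 4, Y 5]
  change Y i ∈ B
  fin_cases i
  exacts [hB _ h0, hB _ h1, hB _ h2, hB _ h3, hu 0, hu 1]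

theorem isOrlikTeraoBetti_pencilForms (hK : (2 : K) ≠ 0) :
    IsOrlikTeraoBetti (pencilForms K) commonBettiTable := by
  have hX := isHomogeneous_X (σ := Fin 6) K
  have h2X : ∀ i : Fin 6, (2 * X i : MvPolynomial (Fin 6) K).IsHomogeneous 1 := fun i => by
    rw [two_mul]
    exact (hX i).add (hX i)
  refine isOrlikTeraoBetti_of_ideal_eq (orlikTeraoIdeal_pencilForms hK)
    (nonempty_resolution_of_quadric_of_signedMinors ?_ ?_ ?_ (prime_signedMinors_pencil K hK)
      (not_dvd_signedMinors_pencil K hK) (isPrime_span_signedMinors_pencil hK)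
      (pencilQuadric_notMem K))
  · intro i
    fin_cases i
    exacts [((h2X _).add (hX _)).sub (hX _), (hX _).add (hX _), (hX _).sub (hX _)]
  · intro i
    fin_cases i
    exacts [(hX _).add (hX _), (hX _).sub (hX _), ((hX _).add (hX _)).sub (h2X _)]
  · exact ((hX _).mul (hX _)).sub ((hX _).mul ((hX _).add (hX _)))

end Pencil

/-! ### The two codes -/

section Codes

open MvPolynomial

variable (K : Type*) [Field K]

/-- The generating matrix of the code of the braid arrangement. -/
def braidMatrix : Matrix (Fin 3) (Fin 6) K :=
  !![1, 0, 0, 1, 1, 0; 0, 1, 0, -1, 0, 1; 0, 0, 1, 0, -1, -1]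

/-- The generating matrix of the code of `x, y, x + y, x - y, z, y - z`. -/
def pencilMatrix : Matrix (Fin 3) (Fin 6) K :=
  !![1, 0, 1, 1, 0, 0; 0, 1, 1, -1, 0, 1; 0, 0, 0, 0, 1, -1]

theorem linearForms_braidMatrix : linearForms (braidMatrix K) = braidForms K := by
  funext j
  fin_cases j <;>
    simp [linearForms, braidMatrix, braidForms, Fin.sum_univ_three, sub_eq_add_neg]

theorem linearForms_pencilMatrix : linearForms (pencilMatrix K) = pencilForms K := by
  funext j
  fin_cases j <;>
    simp [linearForms, pencilMatrix, pencilForms, Fin.sum_univ_three, sub_eq_add_neg]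

variable {K}

theorem pairwise_isRelPrime_of_eval {n k : ℕ} {ℓ : Fin n → MvPolynomial (Fin k) K}
    (hℓ : ∀ i, (ℓ i).IsHomogeneous 1)
    (h : ∀ i j, i < j → ∃ v, eval v (ℓ i) = 0 ∧ eval v (ℓ j) ≠ 0)
    (h0 : ∀ i, ∃ v, eval v (ℓ i) ≠ 0) : Pairwise fun i j => IsRelPrime (ℓ i) (ℓ j) := by
  have hirr : ∀ i, Irreducible (ℓ i) := fun i => irreducible_of_isHomogeneous_one (hℓ i) fun hi => by
    obtain ⟨v, hv⟩ := h0 i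
    exact hv (by rw [hi, map_zero])
  have hlt : ∀ i j, i < j → IsRelPrime (ℓ i) (ℓ j) := by
    intro i j hij
    obtain ⟨v, h₁, h₂⟩ := h i j hij
    exact isRelPrime_of_irreducible_of_eval (hirr i) v h₁ h₂
  intro i j hij
  rcases lt_or_gt_of_ne hij with h | h
  exacts [hlt i j h, (hlt j i h).symm]

theorem pairwise_isRelPrime_braidForms (hK : (2 : K) ≠ 0) :
    Pairwise fun i j => IsRelPrime (braidForms K i) (braidForms K j) := by
  have hX := isHomogeneous_X (σ := Fin 3) K
  have h₁ : (1 : K) + 1 ≠ 0 := by rwa [one_add_one_eq_two]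
  have h₂ : (-1 : K) - 1 ≠ 0 := fun h => h₁ (by linear_combination -h)
  refine pairwise_isRelPrime_of_eval (fun i => ?_) (fun i j hij => ?_) fun i => ?_
  · fin_cases i
    exacts [hX _, hX _, hX _, (hX _).sub (hX _), (hX _).sub (hX _), (hX _).sub (hX _)]
  -- The `i`-th point is a zero of the `i`-th form and of no later one; for the last form there is
  -- nothing to separate.
  · refine ⟨(![![0, 1, -1], ![1, 0, -1], ![1, -1, 0], ![1, 1, -1], ![1, -1, 1], ![-1, 1, 1]] :
      Fin 6 → Fin 3 → K) i, ?_⟩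
    fin_cases i <;> fin_cases j <;> first | exact absurd hij (by decide) | skip
    all_goals simp [braidForms, h₁, h₂]
  · refine ⟨(![![1, 0, 0], ![0, 1, 0], ![0, 0, 1], ![1, 0, 0], ![1, 0, 0], ![0, 1, 0]] :
      Fin 6 → Fin 3 → K) i, ?_⟩
    fin_cases i <;> simp [braidForms]

theorem pairwise_isRelPrime_pencilForms (hK : (2 : K) ≠ 0) :
    Pairwise fun i j => IsRelPrime (pencilForms K i) (pencilForms K j) := by
  have hX := isHomogeneous_X (σ := Fin 3) K
  have h₁ : (1 : K) + 1 ≠ 0 := by rwa [one_add_one_eq_two]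
  have h₂ : (-1 : K) - 1 ≠ 0 := fun h => h₁ (by linear_combination -h)
  refine pairwise_isRelPrime_of_eval (fun i => ?_) (fun i j hij => ?_) fun i => ?_
  · fin_cases i
    exacts [hX _, hX _, (hX _).add (hX _), (hX _).sub (hX _), hX _, (hX _).sub (hX _)]
  · refine ⟨(![![0, 1, -1], ![1, 0, 1], ![1, -1, 1], ![1, 1, -1], ![1, 1, 0], 0] :
      Fin 6 → Fin 3 → K) i, ?_⟩
    fin_cases i <;> fin_cases j <;> first | exact absurd hij (by decide) | skip
    all_goals simp [pencilForms, h₁, h₂]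
  · refine ⟨(![![1, 0, 0], ![0, 1, 0], ![1, 0, 0], ![1, 0, 0], ![0, 0, 1], ![0, 1, 0]] :
      Fin 6 → Fin 3 → K) i, ?_⟩
    fin_cases i <;> simp [pencilForms]

theorem braid_vecMul (v : Fin 3 → K) :
    Matrix.vecMul v (braidMatrix K) = ![v 0, v 1, v 2, v 0 - v 1, v 0 - v 2, v 1 - v 2] := by
  funext i
  fin_cases i <;>
    simp [braidMatrix, Matrix.vecMul, dotProduct, Fin.sum_univ_three, sub_eq_add_neg]

theorem pencil_vecMul (v : Fin 3 → K) :
    Matrix.vecMul v (pencilMatrix K) = ![v 0, v 1, v 0 + v 1, v 0 - v 1, v 2, v 1 - v 2] := by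
  funext i
  fin_cases i <;>
    simp [pencilMatrix, Matrix.vecMul, dotProduct, Fin.sum_univ_three, sub_eq_add_neg]

theorem finrank_matrixCode {n k : ℕ} {G : Matrix (Fin k) (Fin n) K}
    (hG : ∀ v, Matrix.vecMul v G = 0 → v = 0) : Module.finrank K (matrixCode G) = k := by
  rw [matrixCode, LinearMap.finrank_range_of_inj, Module.finrank_fin_fun]
  exact (injective_iff_map_eq_zero G.vecMulLinear).mpr hG

variable [DecidableEq K]

theorem hammingNorm_fin_six (c : Fin 6 → K) : hammingNorm c =
    (if c 0 ≠ 0 then 1 else 0) + (if c 1 ≠ 0 then 1 else 0) + (if c 2 ≠ 0 then 1 else 0) +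
    (if c 3 ≠ 0 then 1 else 0) + (if c 4 ≠ 0 then 1 else 0) + (if c 5 ≠ 0 then 1 else 0) := by
  rw [hammingNorm, Finset.card_filter, Fin.sum_univ_six]

/-- The weight of the codeword of `v` is the number of forms not vanishing at `v`. At most three of
these forms vanish at a nonzero point; `(1, 0, 0)`, where `y, z, y - z` vanish, attains this. -/
theorem isLinearCode_braid : IsLinearCode (matrixCode (braidMatrix K)) 3 3 := by
  refine ⟨finrank_matrixCode fun v hv => ?_, ⟨Matrix.vecMul ![1, 0, 0] (braidMatrix K), ⟨_, rfl⟩,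
    ?_, ?_⟩, ?_⟩
  · rw [braid_vecMul] at hv
    funext i
    fin_cases i
    exacts [congrFun hv 0, congrFun hv 1, congrFun hv 2]
  · rw [braid_vecMul]
    exact fun h => one_ne_zero (congrFun h 0)
  · simp [braid_vecMul, hammingNorm_fin_six]
  · rintro _ ⟨_, ⟨v, rfl⟩, hne, rfl⟩
    change Matrix.vecMul v _ ≠ 0 at hne
    change 3 ≤ hammingNorm (Matrix.vecMul v _)
    rw [hammingNorm_fin_six]
    rw [braid_vecMul] at hne ⊢
    simp only [Matrix.cons_val]
    by_cases h0 : v 0 = 0 <;> by_cases h1 : v 1 = 0 <;> by_cases h2 : v 2 = 0 <;>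
      by_cases h3 : v 0 - v 1 = 0 <;> by_cases h4 : v 0 - v 2 = 0 <;>
      by_cases h5 : v 1 - v 2 = 0 <;> simp_all [sub_eq_zero]

/-- The four forms in `x, y` alone vanish at `(0, 0, 1)`, leaving weight two; no nonzero point is a
zero of five forms. -/
theorem isLinearCode_pencil : IsLinearCode (matrixCode (pencilMatrix K)) 3 2 := by
  refine ⟨finrank_matrixCode fun v hv => ?_, ⟨Matrix.vecMul ![0, 0, 1] (pencilMatrix K), ⟨_, rfl⟩,
    ?_, ?_⟩, ?_⟩
  · rw [pencil_vecMul] at hv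
    funext i
    fin_cases i
    exacts [congrFun hv 0, congrFun hv 1, congrFun hv 4]
  · rw [pencil_vecMul]
    exact fun h => one_ne_zero (congrFun h 4)
  · simp [pencil_vecMul, hammingNorm_fin_six]
  · rintro _ ⟨_, ⟨v, rfl⟩, hne, rfl⟩
    change Matrix.vecMul v _ ≠ 0 at hne
    change 2 ≤ hammingNorm (Matrix.vecMul v _)
    rw [hammingNorm_fin_six]
    rw [pencil_vecMul] at hne ⊢
    simp only [Matrix.cons_val]
    by_cases h0 : v 0 = 0 <;> by_cases h1 : v 1 = 0 <;> by_cases h2 : v 2 = 0 <;>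
      by_cases h3 : v 0 - v 1 = 0 <;> by_cases h4 : v 0 + v 1 = 0 <;>
      by_cases h5 : v 1 - v 2 = 0 <;> simp_all [sub_eq_zero]

end Codes

theorem proposition3p11 {K : Type*} [Field K] [DecidableEq K] (hK : (2 : K) ≠ 0) :
    (∃ G₁ G₂ : Matrix (Fin 3) (Fin 6) K,
      linearForms G₁ =
        ![MvPolynomial.X 0, MvPolynomial.X 1, MvPolynomial.X 2,
          MvPolynomial.X 0 - MvPolynomial.X 1, MvPolynomial.X 0 - MvPolynomial.X 2,
          MvPolynomial.X 1 - MvPolynomial.X 2] ∧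
      linearForms G₂ =
        ![MvPolynomial.X 0, MvPolynomial.X 1, MvPolynomial.X 0 + MvPolynomial.X 1,
          MvPolynomial.X 0 - MvPolynomial.X 1, MvPolynomial.X 2,
          MvPolynomial.X 1 - MvPolynomial.X 2] ∧
      Pairwise (fun i j => IsRelPrime (linearForms G₁ i) (linearForms G₁ j)) ∧
      Pairwise (fun i j => IsRelPrime (linearForms G₂ i) (linearForms G₂ j)) ∧
      IsLinearCode (matrixCode G₁) 3 3 ∧
      IsLinearCode (matrixCode G₂) 3 2 ∧
      IsOrlikTeraoBetti (linearForms G₁) commonBettiTable ∧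
      IsOrlikTeraoBetti (linearForms G₂) commonBettiTable) ∧
    ¬ ∃ f : ℕ → ℕ → (ℕ → ℕ → ℕ) → ℕ,
      ∀ (n k d : ℕ) (G : Matrix (Fin k) (Fin n) K) (β : ℕ → ℕ → ℕ),
        IsLinearCode (matrixCode G) k d →
        Pairwise (fun i j => IsRelPrime (linearForms G i) (linearForms G j)) →
        IsOrlikTeraoBetti (linearForms G) β →
        d = f n k β := by

  have B₁ := isOrlikTeraoBetti_braidForms K hK
  have B₂ := isOrlikTeraoBetti_pencilForms (K := K) hK
  have P₁ := pairwise_isRelPrime_braidForms (K := K) hK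
  have P₂ := pairwise_isRelPrime_pencilForms (K := K) hK
  rw [← linearForms_braidMatrix] at B₁ P₁
  rw [← linearForms_pencilMatrix] at B₂ P₂
  refine ⟨⟨braidMatrix K, pencilMatrix K, linearForms_braidMatrix K, linearForms_pencilMatrix K,
    P₁, P₂, isLinearCode_braid, isLinearCode_pencil, B₁, B₂⟩, ?_⟩
  rintro ⟨f, hf⟩
  have h := (hf 6 3 3 _ _ isLinearCode_braid P₁ B₁).trans
    (hf 6 3 2 _ _ isLinearCode_pencil P₂ B₂).symm
  omega
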